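/- There is a universal constant $C>0$ such that the following holds. Let $\mathcal{X}$ be a measurable space, $\mathcal{Y}=\{\pm1\}$, $\mathcal{D}$ a probability distribution on $\mathcal{X}\times\mathcal{Y}$, $\mathcal{H}\subseteq\mathcal{Y}^{\mathcal{X}}$ a hypothesis class, and $\mathcal{T}$ a finite nonempty set of maps $T:\mathcal{X}\to\mathcal{X}$. Let $\mathcal{H}\circ\mathcal{T}=\{h\circ T: h\in\mathcal{H},T\in\mathcal{T}\}$ and let $\mathrm{vc}$ denote VC dimension. Assume $\mathrm{vc}(\mathcal{H}\circ\mathcal{T})<\infty$, that every $h\circ T\in\mathcal{H}\circ\mathcal{T}$ is measurable, and that the zero-one loss class of $\mathcal{H}\circ\mathcal{T}$ is $\mathcal{D}$-measurable: for all $n$ and $e\in\mathbb{R}^n$ the map $(x_i,y_i)_{i\le n}\mapsto\sup_{f\in\mathcal{H}\circ\mathcal{T}}\big|\sum_{i} e_i\mathbb{1}[f(x_i)\ne y_i]\big|$ is measurable for the completion of $\mathcal{D}^n$. Let $\mathtt{ERM}_{\mathcal{H}}$ be any (black-box) rule that maps every finite labelled sample to an element of $\mathcal{H}$ of least empirical error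 on that sample. Write $$\mathrm{err}(h,T(\mathcal{D}))=\Pr_{(x,y)\sim\mathcal{D}}[h(T(x))\ne y],\qquad \mathrm{err}(h,T(S))=\frac1m\sum_{i=1}^m\mathbb{1}[h(T(x_i))\ne y_i]$$ for $S=((x_1,y_1),\dots,(x_m,y_m))$, and $\mathsf{OPT}_\infty=\inf_{h\in\mathcal{H}}\sup_{T\in\mathcal{T}}\mathrm{err}(h,T(\mathcal{D}))$. Given $S$, positive integers $R$ and $m_{\mathtt{ERM}}$, the algorithm sets $\eta=\sqrt{8\ln|\mathcal{T}|/R}$ and $Q_1=\mathrm{Unif}(\mathcal{T})$, and in each round $r=1,\dots,R$ it * draws $m_{\mathtt{ERM}}$ i.i.d. points $(T(x),y)$ with $T\sim Q_r$ and $(x,y)\sim\mathrm{Unif}(S)$ independent, and lets $h_r$ be the output of $\mathtt{ERM}_{\mathcal{H}}$ on them; * sets $Q_{r+1}(T)=Q_r(T)\exp(-\eta(1-\mathrm{err}(h_r,T(S))))/Z_r$ for every $T\in\mathcal{T}$, where $Z_r$ normalizes $Q_{r+1}$ to a distribution. It returns the uniform mixture $\bar h=\frac1R\sum_{r=1}^R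 h_r$. Let $\varepsilon,\delta,\delta'\in(0,\frac12)$, let $k=\min\{\mathrm{vc}(\mathcal{H}),\,|\mathcal{T}|\cdot\mathrm{vc}(\mathcal{H}\circ\mathcal{T})\}$, and let the positive integers $m,R,m_{\mathtt{ERM}}$ satisfy $$m\ge C\,\frac{\mathrm{vc}(\mathcal{H}\circ\mathcal{T})+\log(1/\delta)}{\varepsilon^2},\qquad R\ge\frac{8\ln|\mathcal{T}|}{\varepsilon^2},\qquad m_{\mathtt{ERM}}\ge C\,\frac{k+\log(R/\delta')}{\varepsilon^2}.$$ Then, with probability at least $1-\delta$ over $S\sim\mathcal{D}^m$, running the algorithm on $S$ produces, with probability at least $1-\delta'$ over its internal sampling, predictors $h_1,\dots,h_R$ with $$\forall T\in\mathcal{T}:\quad \Pr_{\substack{(x,y)\sim\mathcal{D}\\ r\sim\mathrm{Unif}\{1,\dots,R\}}}[h_r(T(x))\neq y]\le\mathsf{OPT}_\infty+\varepsilon.$$ -/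

import Mathlib

open MeasureTheory

namespace TransformLearning

universe u v

/-! Predictors are maps `X → Bool`; `Bool` plays the role of the two-point label space `{±1}`. -/

/-- The class `H ∘ 𝒯 = {h ∘ T : h ∈ H, T ∈ 𝒯}`. -/
def compClass {X : Type u} (H : Set (X → Bool)) (𝒯 : Finset (X → X)) : Set (X → Bool) :=
  {f | ∃ h ∈ H, ∃ T ∈ 𝒯, f = h ∘ T}

/-- `F` shatters the finite set `s`: every labelling of `s` is realised by a member of `F`. -/
def Shatters {X : Type u} (F : Set (X → Bool)) (s : Finset X) : Prop :=
  ∀ b : X → Bool, ∃ f ∈ F, ∀ x ∈ s, f x = b x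

/-- The VC dimension: supremum of the cardinalities of shattered finite sets (possibly `⊤`). -/
noncomputable def vcDim {X : Type u} (F : Set (X → Bool)) : ℕ∞ :=
  ⨆ s : {s : Finset X // Shatters F s}, (s.1.card : ℕ∞)

/-- The zero-one loss of `f` on the labelled point `z`. -/
noncomputable def loss {X : Type u} (f : X → Bool) (z : X × Bool) : ℝ :=
  if f z.1 ≠ z.2 then 1 else 0

/-- Population error `Pr_{(x,y) ∼ D} [f x ≠ y]`.  The error of `h` on the transformed distribution
`T(D)` is `err D (h ∘ T)`. -/
noncomputable def err {X : Type u} [MeasurableSpace X] (D : Measure (X × Bool))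
    (f : X → Bool) : ℝ :=
  D.real {z | f z.1 ≠ z.2}

/-- Empirical error of `f` on the sample `S`.  The error of `h` on the transformed sample
`T(S)` is `empErr S (h ∘ T)`. -/
noncomputable def empErr {X : Type u} {m : ℕ} (S : Fin m → X × Bool) (f : X → Bool) : ℝ :=
  (∑ i, loss f (S i)) / m

/-- `OPT_∞ = inf_{h ∈ H} sup_{T ∈ 𝒯} err(h, T(D))`. -/
noncomputable def optInf {X : Type u} [MeasurableSpace X] (D : Measure (X × Bool))
    (H : Set (X → Bool)) (𝒯 : Finset (X → X)) : ℝ :=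
  ⨅ h : H, ⨆ T : 𝒯, err D (h.1 ∘ T.1)

/-- The usual measurability condition for uniform laws over a possibly uncountable class
(a `D`-measurable class): for every sample size `n` and all weights `e`, the map
`z ↦ sup_{f ∈ F} |∑ i, e i * loss f (z i)|` is measurable for the completion of `D ^ n`. -/
def MeasurableClass {X : Type u} [MeasurableSpace X] (D : Measure (X × Bool))
    (F : Set (X → Bool)) : Prop :=
  ∀ (n : ℕ) (e : Fin n → ℝ),
    AEMeasurable (fun z : Fin n → X × Bool => ⨆ f : F, |∑ i, e i * loss f.1 (z i)|)
      (Measure.pi fun _ => D)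

/-- A (black-box) learning rule: it maps every finite labelled sample to a predictor. -/
abbrev Learner (X : Type u) : Type u := (n : ℕ) → (Fin n → X × Bool) → X → Bool

/-- `A` is an ERM oracle for `H`: on each sample it returns a member of `H` of least
empirical error. -/
def IsERM {X : Type u} (H : Set (X → Bool)) (A : Learner X) : Prop :=
  ∀ (n : ℕ) (z : Fin n → X × Bool),
    A n z ∈ H ∧ ∀ h ∈ H, empErr z (A n z) ≤ empErr z h

/-- `n` independent draws from `p`. -/
noncomputable def iid {α : Type v} (p : PMF α) : (n : ℕ) → PMF (Fin n → α)
  | 0 => PMF.pure Fin.elim0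
  | n + 1 => p.bind fun a => (iid p n).map fun z => (Fin.cons a z : Fin (n + 1) → α)

/-- The distribution over labelled points induced by the distribution `Q` over `𝒯` and
`Unif(S)`: draw `T ∼ Q` and `(x, y) ∼ Unif(S)` independently, return `(T x, y)`. -/
noncomputable def inducedDist {X : Type u} {m : ℕ} [NeZero m] {𝒯 : Finset (X → X)}
    (S : Fin m → X × Bool) (Q : PMF 𝒯) : PMF (X × Bool) :=
  Q.bind fun T => (PMF.uniformOfFintype (Fin m)).map fun i => (T.1 (S i).1, (S i).2)

/-- One step of Multiplicative Weights with step size `η` and losses `l`: the new weight of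
`a` is `Q a * exp (-η * l a) / Z`, with `Z` the normalisation factor. -/
noncomputable def mwUpdate {α : Type v} [Fintype α] (η : ℝ) (Q : PMF α) (l : α → ℝ) : PMF α :=
  PMF.normalize (fun a => Q a * ENNReal.ofReal (Real.exp (-η * l a)))
    (by
      obtain ⟨a, ha⟩ := Q.support_nonempty
      intro h
      have h0 := ENNReal.tsum_eq_zero.mp h a
      rcases mul_eq_zero.mp h0 with h1 | h1
      · exact (Q.mem_support_iff a).mp ha h1
      · exact absurd (ENNReal.ofReal_eq_zero.mp h1) (not_le.mpr (Real.exp_pos _)))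
    (by
      rw [tsum_fintype]
      exact (ENNReal.sum_lt_top.mpr fun a _ =>
        ENNReal.mul_lt_top (Q.apply_lt_top a) ENNReal.ofReal_lt_top).ne)

/-- `R` rounds of the reduction, started from the weights `Q`.  In each round the learner `A` is
run on `n` i.i.d. draws from the distribution induced by the current weights and `Unif(S)`; then
the weights are updated, transformation `T` suffering the loss `1 - err(h, T(S))`, where `h` is the
learner's output.  The result is the law of the sequence of the `R` outputs of the learner. -/
noncomputable def rounds {X : Type u} {m : ℕ} [NeZero m] {𝒯 : Finset (X → X)}
    (A : Learner X) (n : ℕ) (η : ℝ) (S : Fin m → X × Bool) :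
    (R : ℕ) → PMF 𝒯 → PMF (Fin R → X → Bool)
  | 0, _ => PMF.pure Fin.elim0
  | R + 1, Q => (iid (inducedDist S Q) n).bind fun z =>
      (rounds A n η S R (mwUpdate η Q fun T => 1 - empErr S (A n z ∘ T.1))).map
        fun hs => (Fin.cons (A n z) hs : Fin (R + 1) → X → Bool)

/-- The full algorithm: `R` rounds started from uniform weights over `𝒯`, with step size
`η = √(8 ln |𝒯| / R)`. -/
noncomputable def algorithm {X : Type u} {m : ℕ} [NeZero m] (𝒯 : Finset (X → X)) [Nonempty 𝒯]
    (A : Learner X) (n R : ℕ) (S : Fin m → X × Bool) : PMF (Fin R → X → Bool) :=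
  rounds A n (Real.sqrt (8 * Real.log 𝒯.card / R)) S R (PMF.uniformOfFintype 𝒯)

/-- The error on `T(D)` of the uniform mixture of `hs 0, …, hs (R - 1)`, that is
`Pr_{(x,y) ∼ D, r ∼ Unif} [hs r (T x) ≠ y]`. -/
noncomputable def mixErr {X : Type u} [MeasurableSpace X] {R : ℕ} [NeZero R]
    (D : Measure (X × Bool)) (hs : Fin R → X → Bool) (T : X → X) : ℝ :=
  (D.prod (PMF.uniformOfFintype (Fin R)).toMeasure).real
    {p | hs p.2 (T p.1.1) ≠ p.1.2}

end TransformLearning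

namespace TransformLearning

universe u v

/-! The algorithm plays a zero-sum game: multiplicative weights moves mass toward the
transformations on which the current predictor errs, and ERM answers the current weights. Three
facts combine.

Uniform convergence (`uniform_convergence`): frequencies over a class of VC dimension `d` are
`ε`-accurate once `n ε² ≳ d + log (1/δ)`. Avoiding an extra `log (1/ε)` requires chaining. A
separated set of traces stays distinct on few random coordinates, so Sauer-Shelah bounds its size
(`card_le_of_separated`); Dudley's chain through such nets controls the Rademacher process
(`card_rademacher_sup_gt_le`); a ghost sample and random exchanges reduce deviations to that
process.

Applied to `H ∘ 𝒯` under `D`, this makes errors on `T(S)` and `T(D)` agree for all `h` and `T`.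
Applied inside a round to the finite space of pairs `(T, i)`, whose loss class has VC dimension at
most `k`, it shows that ERM is nearly optimal against the current weights (`round_excess_error`).
The weighted error of the output is then at most `OPT + ε / 4`, since any average over `𝒯` is below
the maximum.

Regret: if every round has weighted error at most `a`, the exponential potential shrinks by a fixed
factor per round (`goodRun_cons`). Comparing it with the term of one `T` gives average error at most
`a + η / 4` on every `T(S)` (`sum_empErr_le_of_goodRun`), and uniform convergence carries this back
to `T(D)`. -/

/-! ### Growth function and packing numbers of VC classes. -/

open Finset in
/-- **Sauer-Shelah lemma** for the traces of a family on a finite sequence of points. -/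
theorem card_traces_le {ι : Type*} {Z : Type*} {α : Type*} [Fintype α] {f : ι → Z → Bool} {d : ℕ}
    (hvc : ∀ s : Finset Z, Shatters (Set.range f) s → s.card ≤ d) (w : α → Z)
    (W : Finset (α → Bool)) (hW : ∀ v ∈ W, ∃ i, v = f i ∘ w) :
    W.card ≤ ∑ k ∈ Iic d, (Fintype.card α).choose k := by
  classical
  let φ : (α → Bool) → Finset α := fun v => univ.filter fun a => v a = true
  have hφ : Function.Injective φ := by
    intro v v' h
    funext a
    have := congrArg (a ∈ ·) h
    simp only [φ, mem_filter, mem_univ, true_and, eq_iff_iff] at this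
    exact Bool.eq_iff_iff.mpr this
  have hvcW : (W.image φ).vcDim ≤ d := by
    refine Finset.sup_le fun s hs => ?_
    rw [mem_shatterer] at hs
    have key : ∀ t ⊆ s, ∃ i, ∀ a ∈ s, f i (w a) = true ↔ a ∈ t := by
      intro t ht
      obtain ⟨u, hu, hsu⟩ := hs ht
      obtain ⟨v, hv, rfl⟩ := mem_image.mp hu
      obtain ⟨i, rfl⟩ := hW v hv
      refine ⟨i, fun a ha => ?_⟩
      rw [← hsu]
      simp [φ, ha]
    -- The trace `{a}` separates `a` from every other index of `s`, so a shattered index set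
    -- contains no repeated sample point.
    have hinj : Set.InjOn w s := by
      intro a ha b hb hab
      obtain ⟨i, hi⟩ := key {a} (by simpa using ha)
      have h1 := (hi a ha).2 (mem_singleton_self a)
      rw [hab] at h1
      exact (mem_singleton.mp ((hi b hb).1 h1)).symm
    rw [← card_image_of_injOn hinj]
    apply hvc
    intro b
    obtain ⟨i, hi⟩ := key (s.filter fun a => b (w a) = true) (filter_subset _ _)
    refine ⟨f i, ⟨i, rfl⟩, fun x hx => ?_⟩
    obtain ⟨a, ha, rfl⟩ := mem_image.mp hx
    have := hi a ha
    simp only [mem_filter, ha, true_and] at this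
    exact Bool.eq_iff_iff.mpr this
  calc W.card = (W.image φ).card := (card_image_of_injective _ hφ).symm
    _ ≤ (W.image φ).shatterer.card := card_le_card_shatterer _
    _ ≤ ∑ k ∈ Iic (W.image φ).vcDim, (Fintype.card α).choose k := card_shatterer_le_sum_vcDim
    _ ≤ _ := sum_le_sum_of_subset (Iic_subset_Iic.mpr hvcW)

-- Replacing `t ^ d` by the larger `t ^ k` leaves part of the binomial expansion of `(1 + t) ^ s`.
-- The free parameter `t` is later tuned to the separation scale.
open Finset in
theorem pow_mul_sum_choose_le (d s : ℕ) {t : ℝ} (h0 : 0 < t) (h1 : t ≤ 1) :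
    t ^ d * ∑ k ∈ Iic d, (s.choose k : ℝ) ≤ (1 + t) ^ s := by
  -- The range is padded by vanishing terms so that it contains `Iic d` even when `d > s`.
  have h2 : (1 + t) ^ s = ∑ k ∈ range (s + 1 + d), t ^ k * (s.choose k : ℝ) := by
    rw [add_comm 1 t, add_pow]
    simp only [one_pow, mul_one]
    refine sum_subset (range_subset_range.mpr (by omega)) fun k _ hk => ?_
    rw [Nat.choose_eq_zero_of_lt (by simpa using hk)]
    simp
  rw [h2, mul_sum]
  calc ∑ k ∈ Iic d, t ^ d * (s.choose k : ℝ) ≤ ∑ k ∈ Iic d, t ^ k * (s.choose k : ℝ) := by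
        refine sum_le_sum fun k hk => mul_le_mul_of_nonneg_right ?_ (by positivity)
        exact pow_le_pow_of_le_one h0.le h1 (mem_Iic.mp hk)
    _ ≤ _ := by
        refine sum_le_sum_of_subset_of_nonneg (fun k hk => ?_) fun _ _ _ => by positivity
        have := mem_Iic.mp hk
        exact mem_range.mpr (by omega)

open Finset in
/-- Few random coordinates suffice to distinguish all members of a separated family. -/
theorem exists_separating_coordinates {n s : ℕ} (hn : 0 < n) (W : Finset (Fin n → Bool)) {γ : ℝ}
    (hsep : ∀ v ∈ W, ∀ w ∈ W, v ≠ w → γ * n < hammingDist v w)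
    (hs : (W.card : ℝ) ^ 2 * Real.exp (-γ * s) < 1) :
    ∃ g : Fin s → Fin n, ∀ v ∈ W, ∀ w ∈ W, v ≠ w → ∃ j, v (g j) ≠ w (g j) := by
  classical
  -- Union bound by counting: a fixed pair agrees on at most `(1 - γ) n` coordinates, hence on all
  -- of `g` for at most `exp (-γ s) n ^ s` choices of `g`.
  by_contra! hcon
  have hsub : (univ : Finset (Fin s → Fin n)) ⊆ W.offDiag.biUnion fun p =>
      Fintype.piFinset fun _ => univ.filter fun i => p.1 i = p.2 i := by
    intro g _
    obtain ⟨v, hv, w, hw, hvw, h⟩ := hcon g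
    simp only [mem_biUnion, mem_offDiag, Fintype.mem_piFinset, mem_filter, mem_univ, true_and]
    exact ⟨(v, w), ⟨hv, hw, hvw⟩, h⟩
  have hcard := (card_le_card hsub).trans card_biUnion_le
  have hnR : (0 : ℝ) < n := by exact_mod_cast hn
  have hterm : ∀ p ∈ W.offDiag, ((Fintype.piFinset fun _ : Fin s =>
      univ.filter fun i => p.1 i = p.2 i).card : ℝ) ≤ Real.exp (-γ * s) * n ^ s := by
    intro p hp
    obtain ⟨h1, h2, h3⟩ := mem_offDiag.mp hp
    have hd := hsep _ h1 _ h2 h3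
    have hsum : (univ.filter fun i => p.1 i = p.2 i).card + hammingDist p.1 p.2 = n := by
      have := card_filter_add_card_filter_not (s := (univ : Finset (Fin n)))
        (fun i => p.1 i = p.2 i)
      simpa [hammingDist] using this
    have hsumR : ((univ.filter fun i => p.1 i = p.2 i).card : ℝ) + hammingDist p.1 p.2 = n := by
      exact_mod_cast hsum
    rw [Fintype.card_piFinset]
    simp only [prod_const, card_univ, Fintype.card_fin, Nat.cast_pow]
    calc ((univ.filter fun i => p.1 i = p.2 i).card : ℝ) ^ s ≤ (Real.exp (-γ) * n) ^ s := by
          gcongr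
          have := Real.add_one_le_exp (-γ)
          nlinarith
      _ = _ := by
          rw [mul_pow, ← Real.exp_nat_mul]
          ring_nf
  have hfin : ((n : ℝ) ^ s) ≤ (W.card : ℝ) ^ 2 * (Real.exp (-γ * s) * n ^ s) := by
    calc ((n : ℝ) ^ s) = ((univ : Finset (Fin s → Fin n)).card : ℝ) := by simp
      _ ≤ ∑ p ∈ W.offDiag, ((Fintype.piFinset fun _ : Fin s =>
            univ.filter fun i => p.1 i = p.2 i).card : ℝ) := by exact_mod_cast hcard
      _ ≤ ∑ p ∈ W.offDiag, Real.exp (-γ * s) * n ^ s := sum_le_sum hterm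
      _ = (W.offDiag.card : ℝ) * (Real.exp (-γ * s) * n ^ s) := by simp
      _ ≤ _ := by
          gcongr
          rw [offDiag_card, sq]
          exact_mod_cast Nat.sub_le _ _
  have : (0 : ℝ) < n ^ s := by positivity
  nlinarith

/-- Packing bound for a family of finite VC dimension, in the Hamming metric on a sample. -/
theorem card_le_of_separated {ι : Type*} {Z : Type*} {f : ι → Z → Bool} {d : ℕ}
    (hvc : ∀ s : Finset Z, Shatters (Set.range f) s → s.card ≤ d) {n : ℕ} (hn : 0 < n)
    (z : Fin n → Z) (W : Finset (Fin n → Bool)) (hW : ∀ v ∈ W, ∃ i, v = f i ∘ z) {γ : ℝ}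
    (hγ0 : 0 < γ) (hγ1 : γ ≤ 1)
    (hsep : ∀ v ∈ W, ∀ w ∈ W, v ≠ w → γ * n < hammingDist v w) :
    (W.card : ℝ) ≤ Real.exp (2 * d * Real.log (4 / γ) + 1 / 2) := by
  classical
  rcases Nat.eq_zero_or_pos W.card with h0 | hpos
  · rw [h0]; simp only [Nat.cast_zero]; positivity
  have hN : (0 : ℝ) < W.card := by exact_mod_cast hpos
  have hN1 : (1 : ℝ) ≤ W.card := by exact_mod_cast hpos
  set l := Real.log W.card with hl
  have hl0 : 0 ≤ l := Real.log_nonneg hN1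
  -- Just enough coordinates to make `|W|² exp (-γ s)` less than `1`.
  obtain ⟨s, hs1, hs2⟩ : ∃ s : ℕ, 2 * l / γ < s ∧ (s : ℝ) ≤ 2 * l / γ + 1 :=
    ⟨⌊2 * l / γ⌋₊ + 1, by exact_mod_cast Nat.lt_floor_add_one _, by
      push_cast
      linarith [Nat.floor_le (show 0 ≤ 2 * l / γ by positivity)]⟩
  rw [div_lt_iff₀ hγ0] at hs1
  obtain ⟨g, hg⟩ := exists_separating_coordinates (s := s) hn W hsep (by
    rw [← Real.exp_log hN, ← hl, ← Real.exp_nat_mul, ← Real.exp_add, Real.exp_lt_one_iff]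
    push_cast
    linarith)
  have hinj : Set.InjOn (fun v : Fin n → Bool => v ∘ g) W := by
    intro v hv w hw h
    by_contra hne
    obtain ⟨j, hj⟩ := hg v hv w hw hne
    exact hj (congrFun h j)
  have hcard := card_traces_le hvc (z ∘ g) (W.image fun v => v ∘ g) (by
    intro v hv
    obtain ⟨v', hv', rfl⟩ := Finset.mem_image.mp hv
    obtain ⟨i, rfl⟩ := hW v' hv'
    exact ⟨i, rfl⟩)
  rw [Finset.card_image_of_injOn hinj, Fintype.card_fin] at hcard
  have hcardR : (W.card : ℝ) ≤ ∑ k ∈ Finset.Iic d, (s.choose k : ℝ) := by exact_mod_cast hcard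
  -- With `t = γ / 4` the exponent `γ s / 4` is about `l / 2`, so half of `l = log |W|` survives on
  -- the left and no logarithm of `d` appears.
  have ht := pow_mul_sum_choose_le d s (t := γ / 4) (by positivity) (by linarith)
  have h1 : (γ / 4) ^ d * W.card ≤ Real.exp (γ / 4 * s) := by
    calc (γ / 4) ^ d * W.card ≤ (1 + γ / 4) ^ s :=
          (mul_le_mul_of_nonneg_left hcardR (by positivity)).trans ht
      _ ≤ (Real.exp (γ / 4)) ^ s := by
          gcongr
          linarith [Real.add_one_le_exp (γ / 4)]
      _ = _ := by rw [← Real.exp_nat_mul]; ring_nf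
  have h2 := Real.log_le_log (by positivity) h1
  rw [Real.log_exp, Real.log_mul (by positivity) (by positivity), Real.log_pow, ← hl] at h2
  have h3 : Real.log (γ / 4) = - Real.log (4 / γ) := by
    rw [← Real.log_inv]; congr 1; field_simp
  rw [h3] at h2
  have h4 : γ / 4 * s ≤ l / 2 + γ / 4 := by
    calc γ / 4 * s ≤ γ / 4 * (2 * l / γ + 1) := by gcongr
      _ = _ := by field_simp; ring
  rw [← Real.exp_log hN, ← hl]
  apply Real.exp_le_exp.mpr
  linarith

/-! ### Rademacher sums and chaining. -/

/-- Signs attached to Booleans. -/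
def boolSign (b : Bool) : ℝ := if b then 1 else -1

open Finset in
theorem sum_exp_rademacher_le {n : ℕ} (c : Fin n → ℝ) {D : ℝ} (hD : ∑ i, c i ^ 2 ≤ D) (l : ℝ) :
    ∑ σ : Fin n → Bool, Real.exp (l * ∑ i, boolSign (σ i) * c i) ≤
      2 ^ n * Real.exp (l ^ 2 * D / 2) := by
  have h1 : ∑ σ : Fin n → Bool, Real.exp (l * ∑ i, boolSign (σ i) * c i) =
      ∏ i, ∑ b : Bool, Real.exp (l * (boolSign b * c i)) := by
    rw [prod_univ_sum, Fintype.piFinset_univ]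
    refine sum_congr rfl fun σ _ => ?_
    rw [mul_sum, Real.exp_sum]
  rw [h1]
  calc ∏ i, ∑ b : Bool, Real.exp (l * (boolSign b * c i))
      ≤ ∏ i, (2 * Real.exp ((l * c i) ^ 2 / 2)) := by
        refine prod_le_prod (fun i _ => by positivity) fun i _ => ?_
        have := Real.cosh_le_exp_half_sq (l * c i)
        rw [Real.cosh_eq] at this
        simp only [Fintype.sum_bool, boolSign, if_true, Bool.false_eq_true, if_false, one_mul,
          neg_mul, mul_neg]
        linarith
    _ = 2 ^ n * Real.exp (l ^ 2 * (∑ i, c i ^ 2) / 2) := by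
        rw [prod_mul_distrib, ← Real.exp_sum]
        simp only [prod_const, card_univ, Fintype.card_fin]
        congr 2
        rw [mul_sum, sum_div]
        exact sum_congr rfl fun i _ => by ring
    _ ≤ _ := by gcongr

open Finset in
open scoped Classical in
/-- **Hoeffding's inequality** for Rademacher sums, as a count of sign patterns. -/
theorem card_rademacher_gt_le {n : ℕ} (c : Fin n → ℝ) {D u : ℝ} (hD : ∑ i, c i ^ 2 ≤ D)
    (hD0 : 0 < D) (hu : 0 ≤ u) :
    ((univ.filter fun σ : Fin n → Bool => u < |∑ i, boolSign (σ i) * c i|).card : ℝ) ≤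
      2 * (2 ^ n * Real.exp (-u ^ 2 / (2 * D))) := by
  have one : ∀ c : Fin n → ℝ, ∑ i, c i ^ 2 ≤ D →
      ((univ.filter fun σ : Fin n → Bool => u < ∑ i, boolSign (σ i) * c i).card : ℝ) ≤
        2 ^ n * Real.exp (-u ^ 2 / (2 * D)) := by
    intro c hc
    -- `u / D` minimises the Chernoff exponent `l² D / 2 - l u`.
    have h := sum_exp_rademacher_le c hc (u / D)
    have h2 : ((univ.filter fun σ : Fin n → Bool => u < ∑ i, boolSign (σ i) * c i).card : ℝ) *
        Real.exp (u / D * u) ≤ ∑ σ : Fin n → Bool, Real.exp (u / D * ∑ i, boolSign (σ i) * c i) := by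
      rw [← nsmul_eq_mul]
      refine (card_nsmul_le_sum _ _ _ fun σ hσ => ?_).trans
        (sum_le_sum_of_subset_of_nonneg (filter_subset _ _) fun _ _ _ => (Real.exp_pos _).le)
      have := (mem_filter.mp hσ).2
      gcongr
    have h3 := h2.trans h
    rw [← le_div_iff₀ (Real.exp_pos _)] at h3
    refine h3.trans_eq ?_
    rw [mul_div_assoc, ← Real.exp_sub]
    congr 2
    field_simp
    ring
  have hsub : (univ.filter fun σ : Fin n → Bool => u < |∑ i, boolSign (σ i) * c i|) ⊆
      (univ.filter fun σ : Fin n → Bool => u < ∑ i, boolSign (σ i) * c i) ∪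
      (univ.filter fun σ : Fin n → Bool => u < ∑ i, boolSign (σ i) * (-c i)) := by
    intro σ hσ
    simp only [mem_union, mem_filter, mem_univ, true_and, mul_neg, sum_neg_distrib] at hσ ⊢
    exact lt_abs.mp hσ
  have h1 := one c hD
  have h2 := one (fun i => -c i) (by simpa using hD)
  have h3 := (card_le_card hsub).trans (card_union_le _ _)
  rw [← Nat.cast_le (α := ℝ), Nat.cast_add] at h3
  linarith

-- A separated subset of largest cardinality is a net, since a point far from all its members could
-- be added; `0 ≤ r` makes such a point new.
open Finset in
theorem exists_maximal_separated {n : ℕ} (V : Finset (Fin n → Bool)) (r : ℝ) :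
    ∃ W ⊆ V, (∀ v ∈ W, ∀ w ∈ W, v ≠ w → r < hammingDist v w) ∧
      (0 ≤ r → ∀ v ∈ V, ∃ w ∈ W, (hammingDist v w : ℝ) ≤ r) := by
  classical
  obtain ⟨W, hW, hmax⟩ := exists_max_image
    (V.powerset.filter fun W => ∀ v ∈ W, ∀ w ∈ W, v ≠ w → r < hammingDist v w) card
    ⟨∅, by simp⟩
  simp only [mem_filter, mem_powerset] at hW hmax
  refine ⟨W, hW.1, hW.2, fun hr v hv => ?_⟩
  by_contra! hcon
  have hvW : v ∉ W := fun h => by simpa using (hcon v h).trans_le' hr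
  have := hmax (insert v W) ⟨insert_subset hv hW.1, by
    intro a ha b hb hab
    rcases mem_insert.mp ha with rfl | ha' <;> rcases mem_insert.mp hb with rfl | hb'
    · exact absurd rfl hab
    · exact hcon b hb'
    · rw [hammingDist_comm]; exact hcon a ha'
    · exact hW.2 a ha' b hb' hab⟩
  rw [card_insert_of_notMem hvW] at this
  omega

/-- The `0/1` value of a Boolean. -/
def boolVal (b : Bool) : ℝ := if b then 1 else 0

theorem sum_boolVal_sub_sq {n : ℕ} (v w : Fin n → Bool) :
    ∑ i, (boolVal (v i) - boolVal (w i)) ^ 2 = hammingDist v w := by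
  rw [hammingDist, Finset.card_filter]
  push_cast
  refine Finset.sum_congr rfl fun i _ => ?_
  cases v i <;> cases w i <;> simp [boolVal]

/-- The chaining thresholds, in units of `τ`, always total less than `4`. -/
theorem sum_succ_div_two_pow (j : ℕ) :
    ∑ i ∈ Finset.range j, ((i : ℝ) + 1) / 2 ^ i = 4 - (2 * j + 4) / 2 ^ j := by
  induction j with
  | zero => simp
  | succ j ih =>
    rw [Finset.sum_range_succ, ih]
    push_cast
    field_simp
    ring

/-- Successively finer nets of the traces of a family of finite VC dimension on a sample. -/
theorem exists_nets {ι : Type*} {Z : Type*} {f : ι → Z → Bool} {d : ℕ}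
    (hvc : ∀ s : Finset Z, Shatters (Set.range f) s → s.card ≤ d) {n : ℕ} (hn : 0 < n)
    (z : Fin n → Z) :
    ∃ U : ℕ → Finset (Fin n → Bool), U 0 = {fun _ => false} ∧
      (∀ j, ∀ v ∈ U (j + 1), ∃ i, v = f i ∘ z) ∧
      (∀ j, ((U (j + 1)).card : ℝ) ≤ Real.exp (2 * d * ((j + 2) * Real.log 4) + 1 / 2)) ∧
      ∀ j i, ∃ w ∈ U j, (hammingDist (f i ∘ z) w : ℝ) ≤ (1 / 4) ^ j * n := by
  classical
  choose W hWV hWsep hWnet using fun j : ℕ => exists_maximal_separated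
    (Finset.univ.filter fun v : Fin n → Bool => ∃ i, v = f i ∘ z) ((1 / 4 : ℝ) ^ j * n)
  have hWV' : ∀ j, ∀ v ∈ W j, ∃ i, v = f i ∘ z := fun j v hv => by
    simpa using hWV j hv
  refine ⟨fun j => if j = 0 then {fun _ => false} else W j, rfl, fun j => hWV' (j + 1),
    fun j => ?_, fun j i => ?_⟩
  · have := card_le_of_separated hvc hn z (W (j + 1)) (hWV' (j + 1)) (γ := (1 / 4) ^ (j + 1))
      (by positivity) (pow_le_one₀ (by norm_num) (by norm_num)) (hWsep (j + 1))
    have h2 : (4 : ℝ) / (1 / 4) ^ (j + 1) = 4 ^ (j + 2) := by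
      rw [one_div, inv_pow, div_inv_eq_mul]; ring
    rw [h2, Real.log_pow] at this
    push_cast at this
    exact this
  · by_cases hj : j = 0
    · subst hj
      refine ⟨fun _ => false, by simp, ?_⟩
      have : hammingDist (f i ∘ z) (fun _ => false) ≤ n := by
        simpa using hammingDist_le_card_fintype (x := f i ∘ z) (y := fun _ => false)
      simpa using this
    · simp only [hj, if_false]
      exact hWnet j (by positivity) _ (by simpa using ⟨i, rfl⟩)

/-- The left side adds up the logarithmic costs at level `j`: the size of the finer net, the two
tails of Hoeffding's bound, the share `2 ^ -(j + 1)` of the failure probability, and `l = log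
(1/δ)`. -/
theorem chaining_exponent_le {d j : ℕ} {l : ℝ} (hl : Real.log 2 ≤ l) :
    2 * d * (((j : ℝ) + 2) * Real.log 4) + 1 / 2 + Real.log 2 + (j + 1) * Real.log 2 + l ≤
      6 * (d + l) * ((j : ℝ) + 1) ^ 2 := by
  have h4 : Real.log 4 = 2 * Real.log 2 := by
    rw [show (4 : ℝ) = 2 ^ 2 by norm_num, Real.log_pow]; norm_num
  have h2a := Real.log_two_gt_d9
  have h2b := Real.log_two_lt_d9
  rw [h4]
  set a := Real.log 2
  have hj : (0 : ℝ) ≤ j := Nat.cast_nonneg j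
  have hd : (0 : ℝ) ≤ d := Nat.cast_nonneg d
  have e1 : 2 * d * (((j : ℝ) + 2) * (2 * a)) ≤ 6 * d * ((j : ℝ) + 1) ^ 2 := by
    have : ((j : ℝ) + 2) * a ≤ ((j : ℝ) + 2) * 0.7 := by gcongr; linarith
    have h : ((j : ℝ) + 2) * (2 * a) ≤ 3 * (j + 1) ^ 2 := by nlinarith
    nlinarith
  have e2 : 1 / 2 + a + (j + 1) * a + l ≤ 6 * l * ((j : ℝ) + 1) ^ 2 := by
    have h1 : (j : ℝ) + 1 ≤ (j + 1) ^ 2 := by nlinarith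
    have h3 : 6 * l * ((j : ℝ) + 1) ≤ 6 * l * ((j : ℝ) + 1) ^ 2 := by gcongr; linarith
    nlinarith
  linarith

open Finset in
open scoped Classical in
/-- **Dudley's chaining bound**, in deviation form: the Rademacher process indexed by a family of
VC dimension `d` rarely exceeds a multiple of `√(n (d + log (1/δ)))`. -/
theorem card_rademacher_sup_gt_le {ι : Type*} {Z : Type*} {f : ι → Z → Bool} {d : ℕ}
    (hvc : ∀ s : Finset Z, Shatters (Set.range f) s → s.card ≤ d) {n : ℕ} (hn : 0 < n)
    (z : Fin n → Z) {δ τ : ℝ} (hδ0 : 0 < δ) (hδ : δ ≤ 1 / 2) (hτ : 0 ≤ τ)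
    (hτ2 : 12 * n * (d + Real.log (1 / δ)) ≤ τ ^ 2) :
    ((univ.filter fun σ : Fin n → Bool =>
      ∃ i, 4 * τ < |∑ j, boolSign (σ j) * boolVal (f i (z j))|).card : ℝ) ≤ δ * 2 ^ n := by
  obtain ⟨U, hU0, hUf, hUcard, hUnet⟩ := exists_nets hvc hn z
  have hnR : (0 : ℝ) < n := by exact_mod_cast hn
  set l := Real.log (1 / δ) with hl
  have hl2 : Real.log 2 ≤ l := by
    apply Real.log_le_log (by norm_num)
    rw [le_div_iff₀ hδ0]; linarith
  have hpar : ∀ j, ∀ v : Fin n → Bool, ∃ w, (v ∈ U (j + 1) →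
      w ∈ U j ∧ (hammingDist v w : ℝ) ≤ (1 / 4) ^ j * n) := by
    intro j v
    by_cases hv : v ∈ U (j + 1)
    · obtain ⟨i, rfl⟩ := hUf j v hv
      obtain ⟨w, hw, h⟩ := hUnet j i
      exact ⟨w, fun _ => ⟨hw, h⟩⟩
    · exact ⟨v, fun h => absurd h hv⟩
  choose par hparU hpard using hpar
  let X : (Fin n → Bool) → (Fin n → Bool) → ℝ := fun v σ => ∑ j, boolSign (σ j) * boolVal (v j)
  -- A link at level `j` has squared length at most `n / 4 ^ j`, so this threshold yields a tail
  -- exponent of order `(j + 1)²`, which beats the linear growth of the entropy, while the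
  -- thresholds stay summable.
  let u : ℕ → ℝ := fun j => τ * ((j + 1) / 2 ^ j)
  let Bad : ℕ → Finset (Fin n → Bool) := fun j => (U (j + 1)).biUnion fun a =>
    univ.filter fun σ => u j < |∑ k, boolSign (σ k) * (boolVal (a k) - boolVal (par j a k))|
  have hBad : ∀ j, ((Bad j).card : ℝ) ≤ δ * 2 ^ n * (1 / 2) ^ (j + 1) := by
    intro j
    have h1 : ((Bad j).card : ℝ) ≤ ∑ a ∈ U (j + 1),
        2 * (2 ^ n * Real.exp (-u j ^ 2 / (2 * ((1 / 4) ^ j * n)))) := by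
      refine (Nat.cast_le.mpr card_biUnion_le).trans ?_
      push_cast
      refine sum_le_sum fun a ha => card_rademacher_gt_le _ ?_ (by positivity) (by positivity)
      rw [sum_boolVal_sub_sq]
      exact hpard j a ha
    rw [sum_const, nsmul_eq_mul] at h1
    have h2 : u j ^ 2 / (2 * ((1 / 4) ^ j * n)) = τ ^ 2 * (j + 1) ^ 2 / (2 * n) := by
      have : ((1 : ℝ) / 4) ^ j = 1 / (2 ^ j) ^ 2 := by
        rw [← pow_mul, mul_comm, pow_mul, one_div, inv_pow]; norm_num
      simp only [u]
      rw [this]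
      field_simp
    have h3 : 6 * (d + l) * ((j : ℝ) + 1) ^ 2 ≤ τ ^ 2 * (j + 1) ^ 2 / (2 * n) := by
      rw [le_div_iff₀ (by positivity)]
      calc 6 * (d + l) * ((j : ℝ) + 1) ^ 2 * (2 * n) = 12 * n * (d + l) * ((j : ℝ) + 1) ^ 2 := by
            ring
        _ ≤ _ := by gcongr
    refine h1.trans ?_
    rw [neg_div, h2]
    have hδe : δ = Real.exp (-l) := by
      rw [hl, one_div, Real.log_inv, neg_neg, Real.exp_log hδ0]
    have h5 : ((1 : ℝ) / 2) ^ (j + 1) = Real.exp (-((j + 1) * Real.log 2)) := by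
      rw [Real.exp_neg, one_div, inv_pow]
      congr 1
      rw [← Nat.cast_succ, ← Real.log_pow, Real.exp_log (by positivity)]
    calc ((U (j + 1)).card : ℝ) * (2 * (2 ^ n * Real.exp (-(τ ^ 2 * (j + 1) ^ 2 / (2 * n)))))
        ≤ Real.exp (2 * d * ((j + 2) * Real.log 4) + 1 / 2) *
          (Real.exp (Real.log 2) * (2 ^ n * Real.exp (-(6 * (d + l) * ((j : ℝ) + 1) ^ 2)))) := by
          rw [Real.exp_log (by norm_num : (0 : ℝ) < 2)]
          have := hUcard j
          gcongr
      _ = 2 ^ n * Real.exp ((2 * d * ((j + 2) * Real.log 4) + 1 / 2) + Real.log 2 +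
            -(6 * (d + l) * ((j : ℝ) + 1) ^ 2)) := by
          rw [Real.exp_add _ (-_), Real.exp_add _ (Real.log 2)]
          ring
      _ ≤ 2 ^ n * Real.exp (-l + -((j + 1) * Real.log 2)) := by
          have := chaining_exponent_le (d := d) (j := j) hl2
          gcongr ?_ * Real.exp ?_
          linarith
      _ = _ := by
          rw [Real.exp_add, ← hδe, ← h5]
          ring
  have hchain : ∀ σ : Fin n → Bool, (∀ j, j < n → σ ∉ Bad j) →
      ∀ j, j ≤ n → ∀ a ∈ U j, |X a σ| ≤ ∑ i ∈ range j, u i := by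
    intro σ hσ j
    induction j with
    | zero =>
      intro _ a ha
      rw [hU0, mem_singleton] at ha
      subst ha
      simp [X, boolVal]
    | succ j ih =>
      intro hj a ha
      have h1 := ih (by omega) (par j a) (hparU j a ha)
      have h2 := hσ j (by omega)
      simp only [Bad, mem_biUnion, mem_filter, mem_univ, true_and, not_exists, not_and,
        not_lt] at h2
      have h3 := h2 a ha
      have h4 : ∑ k, boolSign (σ k) * (boolVal (a k) - boolVal (par j a k)) =
          X a σ - X (par j a) σ := by
        simp only [X, mul_sub, sum_sub_distrib]
      rw [h4] at h3
      rw [sum_range_succ]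
      have h5 := abs_sub_abs_le_abs_sub (X a σ) (X (par j a) σ)
      linarith
  have hsub : (univ.filter fun σ : Fin n → Bool =>
      ∃ i, 4 * τ < |∑ j, boolSign (σ j) * boolVal (f i (z j))|) ⊆ (range n).biUnion Bad := by
    intro σ hσ
    by_contra hcon
    simp only [mem_biUnion, mem_range, not_exists, not_and] at hcon
    obtain ⟨i, hi⟩ := (mem_filter.mp hσ).2
    obtain ⟨w, hw, hwd⟩ := hUnet n i
    -- At level `n` the radius `n / 4 ^ n` is below `1`, so the net contains every trace and the
    -- chain is finite.
    have hw0 : hammingDist (f i ∘ z) w = 0 := by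
      have h1 : ((1 : ℝ) / 4) ^ n * n < 1 := by
        rw [one_div, inv_pow, inv_mul_lt_iff₀ (by positivity), mul_one]
        exact_mod_cast Nat.lt_pow_self (by norm_num)
      have : (hammingDist (f i ∘ z) w : ℝ) < 1 := hwd.trans_lt h1
      have : hammingDist (f i ∘ z) w < 1 := by exact_mod_cast this
      omega
    rw [hammingDist_eq_zero] at hw0
    have h1 := hchain σ hcon n le_rfl w hw
    rw [← hw0] at h1
    have h2 : ∑ i ∈ range n, u i ≤ 4 * τ := by
      simp only [u]
      rw [← mul_sum, sum_succ_div_two_pow, mul_comm]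
      gcongr
      linarith [show (0 : ℝ) ≤ (2 * n + 4) / 2 ^ n by positivity]
    exact absurd hi (not_lt.mpr (h1.trans h2))
  calc _ ≤ (((range n).biUnion Bad).card : ℝ) := Nat.cast_le.mpr (card_le_card hsub)
    _ ≤ ∑ j ∈ range n, δ * 2 ^ n * (1 / 2) ^ (j + 1) := by
        refine (Nat.cast_le.mpr card_biUnion_le).trans ?_
        push_cast
        exact sum_le_sum fun j _ => hBad j
    _ = δ * 2 ^ n * (1 - (1 / 2) ^ n) := by
        rw [← mul_sum]
        congr 1
        simp only [pow_succ, ← sum_mul]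
        rw [geom_sum_eq (by norm_num)]
        ring
    _ ≤ δ * 2 ^ n := by
        refine mul_le_of_le_one_right (by positivity) ?_
        linarith [show (0 : ℝ) ≤ (1 / 2) ^ n by positivity]

/-! ### Symmetrisation and uniform convergence. -/

theorem measurable_boolVal : Measurable boolVal := measurable_of_countable _

theorem boolVal_mem_Icc (b : Bool) : boolVal b ∈ Set.Icc (0 : ℝ) 1 := by
  cases b <;> simp [boolVal]

open ProbabilityTheory in
/-- Chebyshev's inequality for the empirical frequency of an event. -/
theorem measure_deviation_ge_le_half {Z : Type*} [MeasurableSpace Z] (P : Measure Z)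
    [IsProbabilityMeasure P] {g : Z → Bool} (hg : Measurable g) {n : ℕ} (hn : 0 < n) {ε : ℝ}
    (hε : 0 < ε) (hnε : 2 ≤ n * ε ^ 2) :
    (Measure.pi fun _ : Fin n => P)
      {z | n * ε / 2 ≤ |∑ j, boolVal (g (z j)) - n * P.real {x | g x = true}|} ≤ 1 / 2 := by
  have hnR : (0 : ℝ) < n := by exact_mod_cast hn
  have hmeas : Measurable fun x => boolVal (g x) := measurable_boolVal.comp hg
  have hmem : MemLp (fun x => boolVal (g x)) 2 P :=
    memLp_of_bounded (Filter.Eventually.of_forall fun x => boolVal_mem_Icc (g x))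
      hmeas.aestronglyMeasurable 2
  have hint : ∫ x, boolVal (g x) ∂P = P.real {x | g x = true} := by
    have : (fun x => boolVal (g x)) = Set.indicator {x | g x = true} fun _ => (1 : ℝ) := by
      funext x
      simp [boolVal, Set.indicator]
    have hs : MeasurableSet {x | g x = true} := hg (measurableSet_singleton true)
    rw [this, integral_indicator_const _ hs]
    simp
  have hmemi : ∀ i : Fin n, MemLp (fun z : Fin n → Z => boolVal (g (z i))) 2
      (Measure.pi fun _ => P) := fun i =>
    hmem.comp_measurePreserving (measurePreserving_eval (fun _ => P) i)
  have hinti : ∀ i : Fin n, ∫ z : Fin n → Z, boolVal (g (z i)) ∂(Measure.pi fun _ => P) =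
      P.real {x | g x = true} := fun i => by
    rw [← hint]
    have h := (measurePreserving_eval (fun _ : Fin n => P) i)
    conv_rhs => rw [← h.map_eq]
    exact (integral_map h.measurable.aemeasurable hmeas.aestronglyMeasurable).symm
  have hvar := variance_sum_pi (μ := fun _ : Fin n => P) (fun _ : Fin n => hmem)
  have hfun : (∑ i, fun ω : Fin n → Z => boolVal (g (ω i))) =
      fun ω => ∑ i, boolVal (g (ω i)) := by
    funext ω; simp
  rw [hfun] at hvar
  have hvarle : Var[fun ω : Fin n → Z => ∑ i, boolVal (g (ω i)); Measure.pi fun _ => P] ≤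
      n / 4 := by
    rw [hvar]
    calc ∑ _i : Fin n, Var[fun x => boolVal (g x); P] ≤ ∑ _i : Fin n, ((1 - 0) / 2 : ℝ) ^ 2 :=
          Finset.sum_le_sum fun _ _ => variance_le_sq_of_bounded
            (Filter.Eventually.of_forall fun x => boolVal_mem_Icc (g x)) hmeas.aemeasurable
      _ = _ := by simp; ring
  have hmemsum : MemLp (fun ω : Fin n → Z => ∑ i, boolVal (g (ω i))) 2
      (Measure.pi fun _ => P) := memLp_finsetSum _ fun i _ => hmemi i
  have hcheb := meas_ge_le_variance_div_sq hmemsum (c := n * ε / 2) (by positivity)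
  have hmean : ∫ ω : Fin n → Z, ∑ i, boolVal (g (ω i)) ∂(Measure.pi fun _ => P) =
      n * P.real {x | g x = true} := by
    rw [integral_finsetSum _ fun i _ => (hmemi i).integrable (by norm_num)]
    simp [hinti]
  rw [hmean] at hcheb
  refine hcheb.trans ?_
  have hhalf : (1 / 2 : ENNReal) = ENNReal.ofReal (1 / 2) := by
    rw [ENNReal.ofReal_div_of_pos (by norm_num)]; simp
  rw [hhalf]
  apply ENNReal.ofReal_le_ofReal
  rw [div_le_iff₀ (by positivity)]
  refine hvarle.trans ?_
  nlinarith

/-- Comparison with a ghost sample: a uniform deviation of the frequencies from the probabilities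
is at most twice as likely as one between two independent samples. -/
theorem measure_exists_deviation_le {ι : Type*} {Z : Type*} [MeasurableSpace Z] (P : Measure Z)
    [IsProbabilityMeasure P] {f : ι → Z → Bool} (hf : ∀ i, Measurable (f i)) {n : ℕ} (hn : 0 < n)
    {ε : ℝ} (hε : 0 < ε) (hnε : 2 ≤ n * ε ^ 2) :
    (Measure.pi fun _ : Fin n => P)
      {z | ∃ i, n * ε < |∑ j, boolVal (f i (z j)) - n * P.real {x | f i x = true}|} ≤
    2 * ((Measure.pi fun _ : Fin n => P).prod (Measure.pi fun _ : Fin n => P))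
      {p | ∃ i, n * ε / 2 < |∑ j, boolVal (f i (p.1 j)) - ∑ j, boolVal (f i (p.2 j))|} := by
  set μ := Measure.pi fun _ : Fin n => P
  set B := {p : (Fin n → Z) × (Fin n → Z) |
    ∃ i, n * ε / 2 < |∑ j, boolVal (f i (p.1 j)) - ∑ j, boolVal (f i (p.2 j))|} with hB
  -- A union over an arbitrary index type need not be measurable; its measurable hull has the same
  -- measure and admits Fubini.
  have hB' := measurableSet_toMeasurable (μ.prod μ) B
  have hsub : {z | ∃ i, n * ε < |∑ j, boolVal (f i (z j)) - n * P.real {x | f i x = true}|} ⊆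
      {z | 1 / 2 ≤ μ (Prod.mk z ⁻¹' toMeasurable (μ.prod μ) B)} := by
    rintro z ⟨i, hi⟩
    -- For the bad `i` of `z`, a ghost sample either deviates by at least `n ε / 2` itself, with
    -- probability at most `1 / 2`, or differs from `z` by more than `n ε / 2`.
    have hcover : (Set.univ : Set (Fin n → Z)) ⊆
        {z' | n * ε / 2 ≤ |∑ j, boolVal (f i (z' j)) - n * P.real {x | f i x = true}|} ∪
        Prod.mk z ⁻¹' toMeasurable (μ.prod μ) B := by
      intro z' _
      by_cases h : n * ε / 2 ≤ |∑ j, boolVal (f i (z' j)) - n * P.real {x | f i x = true}|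
      · exact Or.inl h
      · refine Or.inr (subset_toMeasurable _ _ ⟨i, ?_⟩)
        push Not at h
        have := abs_sub_abs_le_abs_sub
          (∑ j, boolVal (f i (z j)) - n * P.real {x | f i x = true})
          (∑ j, boolVal (f i (z' j)) - n * P.real {x | f i x = true})
        rw [sub_sub_sub_cancel_right] at this
        simp only
        linarith
    have h1 := (measure_mono hcover).trans (measure_union_le (μ := μ) _ _)
    rw [measure_univ] at h1
    have h2 := h1.trans (add_le_add_left (measure_deviation_ge_le_half P (hf i) hn hε hnε) _)
    have h4 : (1 / 2 : ENNReal) + 1 / 2 ≤ 1 / 2 + μ (Prod.mk z ⁻¹' toMeasurable (μ.prod μ) B) :=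
      (by rw [one_div, ENNReal.inv_two_add_inv_two] : (1 / 2 : ENNReal) + 1 / 2 = 1).trans_le h2
    exact (ENNReal.add_le_add_iff_left (by simp)).mp h4
  have hmark := mul_meas_ge_le_lintegral (μ := μ)
    (measurable_measure_prodMk_left (ν := μ) hB') (1 / 2)
  rw [← Measure.prod_apply hB', measure_toMeasurable] at hmark
  calc μ _ ≤ μ {z | 1 / 2 ≤ μ (Prod.mk z ⁻¹' toMeasurable (μ.prod μ) B)} := measure_mono hsub
    _ = 2 * (1 / 2 * μ {z | 1 / 2 ≤ μ (Prod.mk z ⁻¹' toMeasurable (μ.prod μ) B)}) := by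
        rw [← mul_assoc, one_div, ENNReal.mul_inv_cancel (by simp) (by simp), one_mul]
    _ ≤ _ := by gcongr

/-- Exchange of the coordinates of two samples wherever `σ` is `false`. -/
def swapSample {Z : Type*} {n : ℕ} (σ : Fin n → Bool) (p : (Fin n → Z) × (Fin n → Z)) :
    (Fin n → Z) × (Fin n → Z) :=
  (fun j => if σ j then p.1 j else p.2 j, fun j => if σ j then p.2 j else p.1 j)

/-- Regrouped as a sample of pairs, the exchange acts coordinatewise by the identity or the swap,
both of which preserve `P.prod P`. -/
theorem measurePreserving_swapSample {Z : Type*} [MeasurableSpace Z] (P : Measure Z)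
    [IsProbabilityMeasure P] {n : ℕ} (σ : Fin n → Bool) :
    MeasurePreserving (swapSample (Z := Z) σ)
      ((Measure.pi fun _ : Fin n => P).prod (Measure.pi fun _ : Fin n => P))
      ((Measure.pi fun _ : Fin n => P).prod (Measure.pi fun _ : Fin n => P)) := by
  have h1 := measurePreserving_arrowProdEquivProdArrow Z Z (Fin n) (fun _ => P) (fun _ => P)
  have h2 := measurePreserving_pi (fun _ : Fin n => P.prod P) (fun _ : Fin n => P.prod P)
    (f := fun j q => if σ j then q else q.swap) (fun j => by
      cases hj : σ j
      · simpa using Measure.measurePreserving_swap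
      · simpa using! MeasurePreserving.id _)
  have h3 := h1.comp (h2.comp (h1.symm _))
  convert h3 using 1
  funext p
  refine Prod.ext ?_ ?_ <;> funext j <;> cases hj : σ j <;>
    simp [swapSample, hj, MeasurableEquiv.arrowProdEquivProdArrow, Equiv.arrowProdEquivProdArrow]

theorem measurePreserving_append {Z : Type*} [MeasurableSpace Z] (P : Measure Z)
    [IsProbabilityMeasure P] (m n : ℕ) :
    MeasurePreserving (fun p : (Fin m → Z) × (Fin n → Z) => Fin.append p.1 p.2)
      ((Measure.pi fun _ => P).prod (Measure.pi fun _ => P)) (Measure.pi fun _ => P) := by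
  have hm : Measurable fun p : (Fin m → Z) × (Fin n → Z) => Fin.append p.1 p.2 := by
    rw [measurable_pi_iff]
    intro k
    refine Fin.addCases (fun i => ?_) (fun i => ?_) k
    · simpa using! (measurable_pi_apply i).comp measurable_fst
    · simpa using! (measurable_pi_apply i).comp measurable_snd
  refine ⟨hm, (Measure.pi_eq fun s hs => ?_).symm⟩
  rw [Measure.map_apply hm (MeasurableSet.univ_pi hs)]
  have : (fun p : (Fin m → Z) × (Fin n → Z) => Fin.append p.1 p.2) ⁻¹' Set.pi Set.univ s =
      (Set.pi Set.univ fun i => s (Fin.castAdd n i)) ×ˢ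
        (Set.pi Set.univ fun i => s (Fin.natAdd m i)) := by
    ext p
    simp only [Set.mem_preimage, Set.mem_pi, Set.mem_univ, forall_true_left, Set.mem_prod]
    constructor
    · intro h
      exact ⟨fun i => by simpa using h (Fin.castAdd n i), fun i => by simpa using h (Fin.natAdd m i)⟩
    · rintro ⟨h1, h2⟩ k
      refine Fin.addCases (fun i => ?_) (fun i => ?_) k
      · simpa using h1 i
      · simpa using h2 i
  rw [this, Measure.prod_prod, Measure.pi_pi, Measure.pi_pi, Fin.prod_univ_add]

/-- The sign-symmetrised double-sample deviation event. -/
def signedDeviation {ι : Type*} {Z : Type*} (f : ι → Z → Bool) {n : ℕ} (t : ℝ)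
    (σ : Fin n → Bool) : Set ((Fin n → Z) × (Fin n → Z)) :=
  {p | ∃ i, t < |∑ j, boolSign (σ j) * (boolVal (f i (p.1 j)) - boolVal (f i (p.2 j)))|}

theorem bddAbove_weighted_sum {ι : Type*} {Z : Type*} (f : ι → Z → Bool) {n : ℕ}
    (e : Fin n → ℝ) (z : Fin n → Z) :
    BddAbove (Set.range fun i => |∑ k, e k * boolVal (f i (z k))|) := by
  refine ⟨∑ k, |e k|, ?_⟩
  rintro _ ⟨i, rfl⟩
  refine (Finset.abs_sum_le_sum_abs _ _).trans (Finset.sum_le_sum fun k _ => ?_)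
  have h := boolVal_mem_Icc (f i (z k))
  rw [abs_mul, abs_of_nonneg h.1]
  exact mul_le_of_le_one_right (abs_nonneg _) h.2

/-- Two samples appended form one of length `n + n`, and the weights `(σ, -σ)` turn the signed
difference into a weighted sum covered by the measurability assumption. -/
theorem nullMeasurableSet_signedDeviation {ι : Type*} [Nonempty ι] {Z : Type*} [MeasurableSpace Z]
    (P : Measure Z) [IsProbabilityMeasure P] {f : ι → Z → Bool} {n : ℕ}
    (hsup : ∀ e : Fin (n + n) → ℝ, AEMeasurable
      (fun z : Fin (n + n) → Z => ⨆ i, |∑ k, e k * boolVal (f i (z k))|) (Measure.pi fun _ => P))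
    (t : ℝ) (σ : Fin n → Bool) :
    NullMeasurableSet (signedDeviation f t σ)
      ((Measure.pi fun _ : Fin n => P).prod (Measure.pi fun _ : Fin n => P)) := by
  let e : Fin (n + n) → ℝ := Fin.append (fun j => boolSign (σ j)) fun j => -boolSign (σ j)
  have h := (hsup e).comp_quasiMeasurePreserving
    (measurePreserving_append P n n).quasiMeasurePreserving
  have h2 := nullMeasurableSet_lt (aemeasurable_const (b := t)) h
  convert h2 using 1
  ext p
  simp only [signedDeviation, Set.mem_ofPred_eq, Function.comp]
  have hsum : ∀ i, ∑ k, e k * boolVal (f i (Fin.append p.1 p.2 k)) =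
      ∑ j, boolSign (σ j) * (boolVal (f i (p.1 j)) - boolVal (f i (p.2 j))) := by
    intro i
    rw [Fin.sum_univ_add, ← Finset.sum_add_distrib]
    refine Finset.sum_congr rfl fun j _ => ?_
    simp only [e, Fin.append_left, Fin.append_right]
    ring
  rw [lt_ciSup_iff (bddAbove_weighted_sum f e _)]
  simp only [hsum]

theorem swapSample_preimage_signedDeviation {ι : Type*} {Z : Type*} (f : ι → Z → Bool) {n : ℕ}
    (t : ℝ) (σ : Fin n → Bool) :
    swapSample σ ⁻¹' signedDeviation f t (fun _ => true) = signedDeviation f t σ := by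
  ext p
  simp only [signedDeviation, Set.mem_preimage, Set.mem_ofPred_eq]
  refine exists_congr fun i => ?_
  have : ∑ j, boolSign true * (boolVal (f i ((swapSample σ p).1 j)) -
      boolVal (f i ((swapSample σ p).2 j))) =
      ∑ j, boolSign (σ j) * (boolVal (f i (p.1 j)) - boolVal (f i (p.2 j))) := by
    refine Finset.sum_congr rfl fun j _ => ?_
    cases hj : σ j <;> simp [swapSample, boolSign, hj]
  rw [this]

open Finset in
open scoped Classical in
theorem card_signedDeviation_le {ι : Type*} {Z : Type*} {f : ι → Z → Bool} {n : ℕ} {t b : ℝ}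
    (hrad : ∀ z : Fin n → Z, ((univ.filter fun σ : Fin n → Bool =>
      ∃ i, t / 2 < |∑ j, boolSign (σ j) * boolVal (f i (z j))|).card : ℝ) ≤ b)
    (p : (Fin n → Z) × (Fin n → Z)) :
    ((univ.filter fun σ : Fin n → Bool => p ∈ signedDeviation f t σ).card : ℝ) ≤ 2 * b := by
  have hsub : (univ.filter fun σ : Fin n → Bool => p ∈ signedDeviation f t σ) ⊆
      (univ.filter fun σ : Fin n → Bool =>
        ∃ i, t / 2 < |∑ j, boolSign (σ j) * boolVal (f i (p.1 j))|) ∪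
      (univ.filter fun σ : Fin n → Bool =>
        ∃ i, t / 2 < |∑ j, boolSign (σ j) * boolVal (f i (p.2 j))|) := by
    intro σ hσ
    obtain ⟨i, hi⟩ := (mem_filter.mp hσ).2
    simp only [mul_sub, sum_sub_distrib] at hi
    simp only [mem_union, mem_filter, mem_univ, true_and]
    by_contra! hcon
    have h1 := hcon.1 i
    have h2 := hcon.2 i
    have := abs_sub (∑ j, boolSign (σ j) * boolVal (f i (p.1 j)))
      (∑ j, boolSign (σ j) * boolVal (f i (p.2 j)))
    linarith
  have h3 := (card_le_card hsub).trans (card_union_le _ _)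
  rw [← Nat.cast_le (α := ℝ), Nat.cast_add] at h3
  linarith [hrad p.1, hrad p.2]

open Finset in
open scoped Classical in
/-- Symmetrisation by random signs of the deviation between two samples. -/
theorem measure_double_sample_le {ι : Type*} [Nonempty ι] {Z : Type*} [MeasurableSpace Z]
    (P : Measure Z) [IsProbabilityMeasure P] {f : ι → Z → Bool} {n : ℕ}
    (hsup : ∀ e : Fin (n + n) → ℝ, AEMeasurable
      (fun z : Fin (n + n) → Z => ⨆ i, |∑ k, e k * boolVal (f i (z k))|) (Measure.pi fun _ => P))
    {t δ : ℝ} (hrad : ∀ z : Fin n → Z, ((univ.filter fun σ : Fin n → Bool =>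
      ∃ i, t / 2 < |∑ j, boolSign (σ j) * boolVal (f i (z j))|).card : ℝ) ≤ δ * 2 ^ n) :
    ((Measure.pi fun _ : Fin n => P).prod (Measure.pi fun _ : Fin n => P))
      (signedDeviation f t fun _ => true) ≤ ENNReal.ofReal (2 * δ) := by
  set μ := (Measure.pi fun _ : Fin n => P).prod (Measure.pi fun _ : Fin n => P)
  have hnull := nullMeasurableSet_signedDeviation P hsup t
  -- All sign patterns give equal measure, so it suffices to bound the number of bad patterns at
  -- each fixed pair of samples.
  have hσ : ∀ σ, μ (signedDeviation f t σ) = μ (signedDeviation f t fun _ => true) := fun σ => by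
    rw [← swapSample_preimage_signedDeviation f t σ]
    exact (measurePreserving_swapSample P σ).measure_preimage (hnull _)
  have h1 : ∑ σ : Fin n → Bool, μ (signedDeviation f t σ) =
      2 ^ n * μ (signedDeviation f t fun _ => true) := by
    simp [hσ]
  have h2 : ∑ σ : Fin n → Bool, μ (signedDeviation f t σ) ≤ ENNReal.ofReal (2 * (δ * 2 ^ n)) := by
    calc ∑ σ : Fin n → Bool, μ (signedDeviation f t σ)
        = ∑ σ : Fin n → Bool, ∫⁻ p, (signedDeviation f t σ).indicator 1 p ∂μ :=
          sum_congr rfl fun σ _ => (lintegral_indicator_one₀ (hnull σ)).symm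
      _ = ∫⁻ p, ∑ σ : Fin n → Bool, (signedDeviation f t σ).indicator 1 p ∂μ :=
          (lintegral_finsetSum' _ fun σ _ => aemeasurable_one.indicator₀ (hnull σ)).symm
      _ ≤ ∫⁻ _, ENNReal.ofReal (2 * (δ * 2 ^ n)) ∂μ := by
          refine lintegral_mono fun p => ?_
          have : ∑ σ : Fin n → Bool, (signedDeviation f t σ).indicator (fun _ => (1 : ENNReal)) p =
              ((univ.filter fun σ : Fin n → Bool => p ∈ signedDeviation f t σ).card : ENNReal) := by
            rw [card_filter]
            push_cast
            exact sum_congr rfl fun σ _ => by simp [Set.indicator]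
          refine this.trans_le ?_
          rw [← ENNReal.ofReal_natCast]
          exact ENNReal.ofReal_le_ofReal (card_signedDeviation_le hrad p)
      _ = _ := by simp
  rw [h1, show 2 * (δ * 2 ^ n) = 2 ^ n * (2 * δ) by ring,
    ENNReal.ofReal_mul (by positivity), ENNReal.ofReal_pow (by norm_num), ENNReal.ofReal_ofNat]
    at h2
  exact (ENNReal.mul_le_mul_iff_right (by simp) (by simp)).mp h2

/-- **Uniform convergence** over a class of VC dimension at most `d`, with the sample size
`O((d + log (1/δ)) / ε²)`. -/
theorem uniform_convergence {ι : Type*} [Nonempty ι] {Z : Type*} [MeasurableSpace Z]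
    (P : Measure Z) [IsProbabilityMeasure P] {f : ι → Z → Bool} {d : ℕ}
    (hvc : ∀ s : Finset Z, Shatters (Set.range f) s → s.card ≤ d)
    (hf : ∀ i, Measurable (f i)) {n : ℕ} (hn : 0 < n)
    (hsup : ∀ e : Fin (n + n) → ℝ, AEMeasurable
      (fun z : Fin (n + n) → Z => ⨆ i, |∑ k, e k * boolVal (f i (z k))|) (Measure.pi fun _ => P))
    {ε δ : ℝ} (hε : 0 < ε) (hδ0 : 0 < δ) (hδ : δ ≤ 1 / 2)
    (hnε : 9216 * (d + Real.log (1 / δ)) ≤ n * ε ^ 2) :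
    (Measure.pi fun _ : Fin n => P)
      {z | ∃ i, n * ε < |∑ j, boolVal (f i (z j)) - n * P.real {x | f i x = true}|} ≤
      ENNReal.ofReal δ := by
  have hnR : (0 : ℝ) < n := by exact_mod_cast hn
  have hd : (0 : ℝ) ≤ d := Nat.cast_nonneg d
  have hl2 : Real.log 2 ≤ Real.log (1 / δ) := by
    apply Real.log_le_log (by norm_num)
    rw [le_div_iff₀ hδ0]; linarith
  have hlog2 := Real.log_two_gt_d9
  have h4 : Real.log (1 / (δ / 4)) = Real.log (1 / δ) + 2 * Real.log 2 := by
    rw [show 1 / (δ / 4) = 1 / δ * 2 ^ 2 by field_simp; norm_num,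
      Real.log_mul (by positivity) (by norm_num), Real.log_pow]
    norm_num
  -- The ghost sample and the split into two sign sums each cost a factor `2`, whence `δ / 4`. The
  -- deviation is halved twice, so `4 τ = n ε / 4`. Then `12 · 16² = 3072`, and `log (4/δ) ≤ 3 log
  -- (1/δ)` gives `9216`.
  have hrad := fun z : Fin n → Z => card_rademacher_sup_gt_le hvc hn z (δ := δ / 4)
    (τ := n * ε / 16) (by positivity) (by linarith) (by positivity) (by
      rw [h4]
      have h5 : 3072 * (d + (Real.log (1 / δ) + 2 * Real.log 2)) ≤ n * ε ^ 2 := by linarith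
      calc 12 * n * (d + (Real.log (1 / δ) + 2 * Real.log 2))
          = n / 256 * (3072 * (d + (Real.log (1 / δ) + 2 * Real.log 2))) := by ring
        _ ≤ n / 256 * (n * ε ^ 2) := by gcongr
        _ = _ := by ring)
  refine (measure_exists_deviation_le P hf hn hε (by linarith)).trans ?_
  have hset : {p : (Fin n → Z) × (Fin n → Z) |
      ∃ i, n * ε / 2 < |∑ j, boolVal (f i (p.1 j)) - ∑ j, boolVal (f i (p.2 j))|} =
      signedDeviation f (n * ε / 2) fun _ => true := by
    simp [signedDeviation, boolSign]
  rw [hset]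
  have h6 := measure_double_sample_le P hsup (t := n * ε / 2) (δ := δ / 4)
    (fun z => by
      convert hrad z using 7
      ring)
  calc _ ≤ 2 * ENNReal.ofReal (2 * (δ / 4)) := by gcongr
    _ = ENNReal.ofReal δ := by
        rw [← ENNReal.ofReal_ofNat, ← ENNReal.ofReal_mul (by norm_num)]
        congr 1
        ring

/-! ### Independent draws from discrete distributions. -/

theorem iid_apply {α : Type v} (p : PMF α) (n : ℕ) (z : Fin n → α) :
    iid p n z = ∏ i, p (z i) := by
  classical
  induction n with
  | zero =>
    rw [iid, PMF.pure_apply, if_pos (Subsingleton.elim _ _)]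
    simp
  | succ n ih =>
    rw [iid, PMF.bind_apply, Fin.prod_univ_succ, tsum_eq_single (z 0)]
    · rw [PMF.map_apply, tsum_eq_single (Fin.tail z), if_pos (Fin.cons_self_tail z).symm, ih]
      · rfl
      · intro w hw
        rw [if_neg]
        intro h
        exact hw (by rw [h, Fin.tail_cons])
    · intro a ha
      rw [PMF.map_apply, ENNReal.tsum_eq_zero.mpr, mul_zero]
      intro w
      rw [if_neg]
      intro h
      exact ha (by rw [h, Fin.cons_zero])

theorem iid_map {α β : Type*} (p : PMF α) (g : α → β) (n : ℕ) :
    iid (p.map g) n = (iid p n).map fun z => g ∘ z := by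
  induction n with
  | zero =>
    rw [iid, iid, PMF.pure_map]
    congr 1
    exact Subsingleton.elim _ _
  | succ n ih =>
    rw [iid, iid, PMF.bind_map, PMF.map_bind]
    congr 1
    funext a
    simp only [Function.comp_apply]
    rw [ih, PMF.map_comp, PMF.map_comp]
    congr 1
    funext z
    funext i
    refine Fin.cases ?_ (fun i => ?_) i <;> simp

theorem iid_toMeasure {α : Type*} [Finite α] [MeasurableSpace α] [MeasurableSingletonClass α]
    (p : PMF α) (n : ℕ) : (iid p n).toMeasure = Measure.pi fun _ => p.toMeasure := by
  refine Measure.ext_of_singleton fun z => ?_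
  rw [PMF.toMeasure_apply_singleton _ _ (measurableSet_singleton z), iid_apply,
    Measure.pi_singleton]
  exact Finset.prod_congr rfl fun i _ =>
    (PMF.toMeasure_apply_singleton _ _ (measurableSet_singleton _)).symm

/-- Uniform convergence for independent draws from a distribution on a finite type. -/
theorem iid_uniform_convergence {ι : Type*} [Nonempty ι] {Z : Type*} [Fintype Z] (p : PMF Z)
    {f : ι → Z → Bool} {d : ℕ}
    (hvc : ∀ s : Finset Z, Shatters (Set.range f) s → s.card ≤ d) {n : ℕ} (hn : 0 < n)
    {ε δ : ℝ} (hε : 0 < ε) (hδ0 : 0 < δ) (hδ : δ ≤ 1 / 2)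
    (hnε : 9216 * (d + Real.log (1 / δ)) ≤ n * ε ^ 2) :
    (iid p n).toOuterMeasure
      {z | ∃ i, n * ε < |∑ j, boolVal (f i (z j)) - n * ∑ x, (p x).toReal * boolVal (f i x)|} ≤
      ENNReal.ofReal δ := by
  -- On a finite space with all sets measurable, the measurability hypotheses hold for any family.
  let _ : MeasurableSpace Z := ⊤
  have : MeasurableSingletonClass Z := ⟨fun _ => trivial⟩
  have h := uniform_convergence p.toMeasure hvc (fun i => measurable_of_countable _) hn
    (fun e => (measurable_of_countable _).aemeasurable) hε hδ0 hδ hnε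
  rw [← iid_toMeasure, PMF.toMeasure_apply_eq_toOuterMeasure] at h
  have hP : ∀ i, p.toMeasure.real {x | f i x = true} = ∑ x, (p x).toReal * boolVal (f i x) := ?_
  · simpa only [hP] using h
  intro i
  rw [measureReal_def, PMF.toMeasure_apply_fintype, ENNReal.toReal_sum]
  · refine Finset.sum_congr rfl fun x _ => ?_
    cases hx : f i x <;> simp [boolVal, hx]
  · intro x _
    exact ne_top_of_le_ne_top (p.apply_ne_top x) (Set.indicator_le_self _ _ _)

theorem one_sub_le_of_compl_le {α : Type*} (p : PMF α) (s : Set α) {b : ℝ} (hb : 0 ≤ b)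
    (h : p.toOuterMeasure sᶜ ≤ ENNReal.ofReal b) : ENNReal.ofReal (1 - b) ≤ p.toOuterMeasure s := by
  have h1 : p.toOuterMeasure Set.univ = 1 :=
    (PMF.toOuterMeasure_apply_eq_one_iff p _).mpr (Set.subset_univ _)
  have h2 : (1 : ENNReal) ≤ p.toOuterMeasure s + p.toOuterMeasure sᶜ := by
    rw [← h1, ← Set.union_compl_self s]
    exact measure_union_le _ _
  calc ENNReal.ofReal (1 - b) ≤ 1 - ENNReal.ofReal b := by
        rw [ENNReal.ofReal_sub _ hb, ENNReal.ofReal_one]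
    _ ≤ 1 - p.toOuterMeasure sᶜ := tsub_le_tsub_left h _
    _ ≤ _ := tsub_le_iff_right.mpr h2

/-! ### VC dimension of the loss classes -/

/-- Realising every labelling through `π` forces `π` to be injective on `s`, so the image is a
shattered set of the same size. -/
theorem card_le_vcDim_of_realizes {X Z : Type*} {F : Set (X → Bool)} {π : Z → X} {s : Finset Z}
    (h : ∀ c : Z → Bool, ∃ f ∈ F, ∀ z ∈ s, f (π z) = c z) : (s.card : ℕ∞) ≤ vcDim F := by
  classical
  have hinj : Set.InjOn π s := by
    intro a ha b hb hab
    obtain ⟨f, -, hf⟩ := h fun z => decide (z = a)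
    have h1 := hf a ha
    have h2 := hf b hb
    rw [hab, h2] at h1
    simpa [eq_comm] using h1
  have hsh : Shatters F (s.image π) := by
    intro b
    obtain ⟨f, hfF, hf⟩ := h (b ∘ π)
    refine ⟨f, hfF, fun x hx => ?_⟩
    obtain ⟨z, hz, rfl⟩ := Finset.mem_image.mp hx
    exact hf z hz
  rw [← Finset.card_image_of_injOn hinj]
  exact le_iSup (fun s : {s : Finset X // Shatters F s} => (s.1.card : ℕ∞)) ⟨_, hsh⟩

/-- Comparison with fixed labels `y` is a bijection on labellings, so passing to losses does not
raise the VC dimension. -/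
theorem realizes_of_shatters_loss {X Z : Type*} {F : Set (X → Bool)} {π : Z → X} {y : Z → Bool}
    {s : Finset Z} (h : Shatters (Set.range fun (f : F) z => decide (f.1 (π z) ≠ y z)) s)
    (c : Z → Bool) : ∃ f ∈ F, ∀ z ∈ s, f (π z) = c z := by
  obtain ⟨_, ⟨f, rfl⟩, hf⟩ := h fun z => decide (c z ≠ y z)
  refine ⟨f.1, f.2, fun z hz => ?_⟩
  have := hf z hz
  revert this
  dsimp only
  generalize f.1 (π z) = b
  cases b <;> cases c z <;> cases y z <;> simp

/-- Distinguishing the transformations, a set shattered by the losses of `H` at the transformed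
sample points splits into `|𝒯|` sets shattered by `H ∘ 𝒯`. -/
theorem card_le_mul_vcDim_compClass {X I : Type*} {H : Set (X → Bool)} {𝒯 : Finset (X → X)}
    {x : I → X} {s : Finset (𝒯 × I)}
    (h : ∀ c : 𝒯 × I → Bool, ∃ f ∈ H, ∀ z ∈ s, f (z.1.1 (x z.2)) = c z) :
    (s.card : ℕ∞) ≤ 𝒯.card * vcDim (compClass H 𝒯) := by
  classical
  have hT : ∀ T : 𝒯, ((s.filter fun z => z.1 = T).card : ℕ∞) ≤ vcDim (compClass H 𝒯) := by
    intro T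
    refine card_le_vcDim_of_realizes (π := fun z => x z.2) fun c => ?_
    obtain ⟨f, hf, hfc⟩ := h c
    refine ⟨f ∘ T.1, ⟨f, hf, T.1, T.2, rfl⟩, fun z hz => ?_⟩
    obtain ⟨hz1, rfl⟩ := Finset.mem_filter.mp hz
    exact hfc z hz1
  rw [Finset.card_eq_sum_card_fiberwise (f := Prod.fst) (t := Finset.univ) (by simp)]
  push_cast
  refine (Finset.sum_le_sum fun T _ => hT T).trans ?_
  simp

/-! ### A single round -/

/-- The index set of the transformed sample points, with the distribution that induces
`inducedDist`. -/
noncomputable def indexDist {α : Type*} (m : ℕ) [NeZero m] (Q : PMF α) : PMF (α × Fin m) :=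
  Q.bind fun T => (PMF.uniformOfFintype (Fin m)).map fun i => (T, i)

theorem indexDist_apply {α : Type*} (m : ℕ) [NeZero m] (Q : PMF α) (z : α × Fin m) :
    indexDist m Q z = Q z.1 * (m : ENNReal)⁻¹ := by
  classical
  rw [indexDist, PMF.bind_apply, tsum_eq_single z.1]
  · rw [PMF.map_apply, tsum_eq_single z.2]
    · simp
    · intro i hi
      rw [if_neg]
      rintro h
      exact hi (by rw [h])
  · intro T hT
    rw [PMF.map_apply, ENNReal.tsum_eq_zero.mpr, mul_zero]
    intro i
    rw [if_neg]
    rintro h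
    exact hT (by rw [h])

/-- Working with indices `(T, i)` makes the space finite, so `H` needs no measurability, and
remembers `T`, which the bound `|𝒯| · vc(H ∘ 𝒯)` needs. -/
theorem inducedDist_eq_map {X : Type u} {m : ℕ} [NeZero m] {𝒯 : Finset (X → X)}
    (S : Fin m → X × Bool) (Q : PMF 𝒯) :
    inducedDist S Q = (indexDist m Q).map fun z => (z.1.1 (S z.2).1, (S z.2).2) := by
  rw [inducedDist, indexDist, PMF.map_bind]
  congr 1
  funext T
  rw [PMF.map_comp]
  rfl

theorem boolVal_decide_ne {X : Type u} (f : X → Bool) (z : X × Bool) :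
    boolVal (decide (f z.1 ≠ z.2)) = loss f z := by
  by_cases h : f z.1 = z.2 <;> simp [boolVal, loss, h]

theorem sum_indexDist {X : Type u} {m : ℕ} [NeZero m] {𝒯 : Finset (X → X)}
    (S : Fin m → X × Bool) (Q : PMF 𝒯) (h : X → Bool) :
    ∑ z : 𝒯 × Fin m, (indexDist m Q z).toReal * boolVal (decide (h (z.1.1 (S z.2).1) ≠ (S z.2).2)) =
      ∑ T : 𝒯, (Q T).toReal * empErr S (h ∘ T.1) := by
  rw [Fintype.sum_prod_type]
  refine Finset.sum_congr rfl fun T _ => ?_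
  rw [empErr, Finset.sum_div, Finset.mul_sum]
  refine Finset.sum_congr rfl fun i _ => ?_
  rw [indexDist_apply]
  have := boolVal_decide_ne (h ∘ T.1) (S i)
  simp only [Function.comp_apply] at this
  simp only [this, ENNReal.toReal_mul, ENNReal.toReal_inv, ENNReal.toReal_natCast]
  ring

/-- With high probability, the learner's output in a round nearly minimises over `H` the error
averaged over the current weights. -/
theorem round_excess_error {X : Type u} {m : ℕ} [NeZero m] {𝒯 : Finset (X → X)}
    {H : Set (X → Bool)} {A : Learner X} (hA : IsERM H A) {k : ℕ}
    (hk : min (vcDim H) (𝒯.card * vcDim (compClass H 𝒯)) = k) (S : Fin m → X × Bool)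
    (Q : PMF 𝒯) {n : ℕ} (hn : 0 < n) {ε δ : ℝ} (hε : 0 < ε) (hδ0 : 0 < δ) (hδ : δ ≤ 1 / 2)
    (hnε : 9216 * (k + Real.log (1 / δ)) ≤ n * ε ^ 2) :
    (iid (inducedDist S Q) n).toOuterMeasure
      {z | ¬ ∀ h ∈ H, ∑ T : 𝒯, (Q T).toReal * empErr S (A n z ∘ T.1) ≤
        ∑ T : 𝒯, (Q T).toReal * empErr S (h ∘ T.1) + 2 * ε} ≤ ENNReal.ofReal δ := by
  have : Nonempty H := ⟨⟨A 0 Fin.elim0, (hA 0 _).1⟩⟩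
  have hnR : (0 : ℝ) < n := by exact_mod_cast hn
  let f : H → 𝒯 × Fin m → Bool := fun h z => decide (h.1 (z.1.1 (S z.2).1) ≠ (S z.2).2)
  have hvc : ∀ s : Finset (𝒯 × Fin m), Shatters (Set.range f) s → s.card ≤ k := by
    intro s hs
    have hreal := realizes_of_shatters_loss (π := fun z : 𝒯 × Fin m => z.1.1 (S z.2).1)
      (y := fun z => (S z.2).2) hs
    rw [← Nat.cast_le (α := ℕ∞), ← hk]
    exact le_min (card_le_vcDim_of_realizes hreal)
      (card_le_mul_vcDim_compClass (x := fun i => (S i).1) hreal)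
  have huc := iid_uniform_convergence (indexDist m Q) hvc hn hε hδ0 hδ hnε
  rw [inducedDist_eq_map, iid_map, PMF.toOuterMeasure_map_apply]
  refine (measure_mono ?_).trans huc
  intro z hz
  simp only [Set.mem_preimage, Set.mem_ofPred_eq] at hz ⊢
  by_contra! hcon
  refine hz fun h hh => ?_
  set w : Fin n → X × Bool := (fun z : 𝒯 × Fin m => (z.1.1 (S z.2).1, (S z.2).2)) ∘ z with hw
  have hloss : ∀ g : H, ∑ j, boolVal (f g (z j)) = n * empErr w g.1 := by
    intro g
    rw [empErr, mul_div_cancel₀ _ hnR.ne']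
    exact Finset.sum_congr rfl fun j _ => boolVal_decide_ne g.1 (w j)
  have key : ∀ g : H, |empErr w g.1 - ∑ T : 𝒯, (Q T).toReal * empErr S (g.1 ∘ T.1)| ≤ ε := by
    intro g
    have h1 := hcon g
    rw [hloss, sum_indexDist S Q g.1, ← mul_sub, abs_mul, abs_of_pos hnR] at h1
    exact le_of_mul_le_mul_left h1 hnR
  have h1 := abs_le.mp (key ⟨A n w, (hA n w).1⟩)
  have h2 := abs_le.mp (key ⟨h, hh⟩)
  have h3 := (hA n w).2 h hh
  simp only at h1 h2
  linarith [h1.1, h2.2]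

/-! ### Multiplicative weights -/

theorem sum_toReal_eq_one {α : Type*} [Fintype α] (Q : PMF α) : ∑ a, (Q a).toReal = 1 := by
  rw [← ENNReal.toReal_sum fun a _ => Q.apply_ne_top a, ← tsum_fintype (L := .unconditional _),
    Q.tsum_coe, ENNReal.toReal_one]

open ProbabilityTheory in
/-- **Hoeffding's lemma** for a distribution on a finite type. -/
theorem sum_mul_exp_le {α : Type*} [Fintype α] (Q : PMF α) (η : ℝ) {l : α → ℝ}
    (hl : ∀ a, l a ∈ Set.Icc (0 : ℝ) 1) :
    ∑ a, (Q a).toReal * Real.exp (-η * l a) ≤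
      Real.exp (-η * ∑ a, (Q a).toReal * l a + η ^ 2 / 8) := by
  let _ : MeasurableSpace α := ⊤
  have : MeasurableSingletonClass α := ⟨fun _ => trivial⟩
  have h := (hasSubgaussianMGF_of_mem_Icc (μ := Q.toMeasure) (X := l)
    (measurable_of_countable _).aemeasurable (Filter.Eventually.of_forall hl)).mgf_le (-η)
  rw [mgf, PMF.integral_eq_sum, PMF.integral_eq_sum] at h
  simp only [smul_eq_mul] at h
  set M := ∑ a, (Q a).toReal * l a
  have h2 : ∑ a, (Q a).toReal * Real.exp (-η * l a) =
      Real.exp (-η * M) * ∑ a, (Q a).toReal * Real.exp (-η * (l a - M)) := by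
    rw [Finset.mul_sum]
    refine Finset.sum_congr rfl fun a _ => ?_
    rw [show -η * l a = -η * M + -η * (l a - M) by ring, Real.exp_add]
    ring
  rw [h2, Real.exp_add]
  refine mul_le_mul_of_nonneg_left (h.trans_eq ?_) (Real.exp_pos _).le
  congr 1
  simp
  ring

theorem sum_mul_exp_pos {α : Type*} [Fintype α] (Q : PMF α) (g : α → ℝ) :
    0 < ∑ a, (Q a).toReal * Real.exp (g a) := by
  obtain ⟨a, ha⟩ := Q.support_nonempty
  refine Finset.sum_pos' (fun _ _ => by positivity) ⟨a, Finset.mem_univ a, ?_⟩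
  exact mul_pos (ENNReal.toReal_pos ((Q.mem_support_iff a).mp ha) (Q.apply_ne_top a))
    (Real.exp_pos _)

theorem mwUpdate_toReal {α : Type v} [Fintype α] (η : ℝ) (Q : PMF α) (l : α → ℝ) (a : α) :
    (mwUpdate η Q l a).toReal =
      (Q a).toReal * Real.exp (-η * l a) / ∑ b, (Q b).toReal * Real.exp (-η * l b) := by
  rw [mwUpdate, PMF.normalize_apply, ENNReal.toReal_mul, ENNReal.toReal_inv, ENNReal.toReal_mul,
    ENNReal.toReal_ofReal (Real.exp_pos _).le, tsum_fintype (L := .unconditional _),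
    ENNReal.toReal_sum, div_eq_mul_inv]
  · congr 2
    exact Finset.sum_congr rfl fun b _ => by
      rw [ENNReal.toReal_mul, ENNReal.toReal_ofReal (Real.exp_pos _).le]
  · exact fun b _ => ENNReal.mul_ne_top (Q.apply_ne_top b) ENNReal.ofReal_ne_top

theorem empErr_mem_Icc {X : Type u} {m : ℕ} (S : Fin m → X × Bool) (f : X → Bool) :
    empErr S f ∈ Set.Icc (0 : ℝ) 1 := by
  have h : ∀ i, loss f (S i) ∈ Set.Icc (0 : ℝ) 1 := fun i => by
    rw [← boolVal_decide_ne]; exact boolVal_mem_Icc _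
  refine ⟨div_nonneg (Finset.sum_nonneg fun i _ => (h i).1) (Nat.cast_nonneg m), ?_⟩
  refine div_le_one_of_le₀ ?_ (Nat.cast_nonneg m)
  simpa using Finset.sum_le_sum fun i (_ : i ∈ Finset.univ) => (h i).2

/-- The run `hs` has outputs in `H` and its exponential potential, started from `Q`, decreased as
guaranteed by average errors at most `a` in each round. -/
def GoodRun {X : Type u} {m : ℕ} {𝒯 : Finset (X → X)} (H : Set (X → Bool)) (η a : ℝ)
    (S : Fin m → X × Bool) (Q : PMF 𝒯) {R : ℕ} (hs : Fin R → X → Bool) : Prop :=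
  (∀ r, hs r ∈ H) ∧
    ∑ T : 𝒯, (Q T).toReal * Real.exp (∑ r, -η * (1 - empErr S (hs r ∘ T.1))) ≤
      Real.exp (R * (-η * (1 - a) + η ^ 2 / 8))

/-- The first factor of the potential is the normaliser of `mwUpdate` times the updated weights.
Hoeffding's lemma bounds the normaliser, as the mean loss is at least `1 - a`. -/
theorem goodRun_cons {X : Type u} {m : ℕ} {𝒯 : Finset (X → X)} {H : Set (X → Bool)} {η a : ℝ}
    (hη : 0 ≤ η) {S : Fin m → X × Bool} {Q : PMF 𝒯} {h : X → Bool} (hh : h ∈ H)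
    (ha : ∑ T : 𝒯, (Q T).toReal * empErr S (h ∘ T.1) ≤ a) {R : ℕ} {hs : Fin R → X → Bool}
    (hgood : GoodRun H η a S (mwUpdate η Q fun T => 1 - empErr S (h ∘ T.1)) hs) :
    GoodRun H η a S Q (Fin.cons h hs : Fin (R + 1) → X → Bool) := by
  refine ⟨fun r => Fin.cases hh (fun r => hgood.1 r) r, ?_⟩
  have h1 := hgood.2
  simp only [mwUpdate_toReal, div_mul_eq_mul_div, ← Finset.sum_div] at h1
  rw [div_le_iff₀ (sum_mul_exp_pos Q _)] at h1
  have h2 := sum_mul_exp_le Q η (l := fun T : 𝒯 => 1 - empErr S (h ∘ T.1)) fun T => by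
    have := empErr_mem_Icc S (h ∘ T.1)
    exact ⟨by linarith [this.2], by linarith [this.1]⟩
  have h3 : ∑ T : 𝒯, (Q T).toReal * (1 - empErr S (h ∘ T.1)) =
      1 - ∑ T : 𝒯, (Q T).toReal * empErr S (h ∘ T.1) := by
    simp only [mul_sub, mul_one, Finset.sum_sub_distrib, sum_toReal_eq_one]
  rw [h3] at h2
  have h4 : ∑ T : 𝒯, (Q T).toReal * Real.exp (-η * (1 - empErr S (h ∘ T.1))) ≤
      Real.exp (-η * (1 - a) + η ^ 2 / 8) := by
    refine h2.trans (Real.exp_le_exp.mpr ?_)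
    nlinarith
  have h5 := h1.trans (mul_le_mul_of_nonneg_left h4 (Real.exp_pos _).le)
  rw [← Real.exp_add] at h5
  have h6 : ((R + 1 : ℕ) : ℝ) * (-η * (1 - a) + η ^ 2 / 8) =
      R * (-η * (1 - a) + η ^ 2 / 8) + (-η * (1 - a) + η ^ 2 / 8) := by
    push_cast
    ring
  rw [h6]
  refine (Finset.sum_congr rfl fun T _ => ?_).trans_le h5
  rw [Fin.sum_univ_succ, Real.exp_add, ← mul_assoc]
  simp only [Fin.cons_zero, Fin.cons_succ]

/-- Union bound over rounds. The weights depend on earlier draws, so the round bound is assumed, and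
the induction run, for every `Q`. -/
theorem rounds_goodRun {X : Type u} {m : ℕ} [NeZero m] {𝒯 : Finset (X → X)} {H : Set (X → Bool)}
    {A : Learner X} {n : ℕ} {η a δ : ℝ} (hη : 0 ≤ η) (hδ : 0 ≤ δ) {S : Fin m → X × Bool}
    (hAH : ∀ z, A n z ∈ H)
    (hround : ∀ Q : PMF 𝒯, (iid (inducedDist S Q) n).toOuterMeasure
      {z | ¬ ∑ T : 𝒯, (Q T).toReal * empErr S (A n z ∘ T.1) ≤ a} ≤ ENNReal.ofReal δ) (R : ℕ) :
    ∀ Q : PMF 𝒯, (rounds A n η S R Q).toOuterMeasure {hs | ¬ GoodRun H η a S Q hs} ≤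
      ENNReal.ofReal (R * δ) := by
  induction R with
  | zero =>
    intro Q
    have : {hs : Fin 0 → X → Bool | ¬ GoodRun H η a S Q hs} = ∅ := by
      ext hs
      simpa [GoodRun] using (sum_toReal_eq_one Q).le
    rw [this]
    simp
  | succ R ih =>
    intro Q
    rw [rounds, PMF.toOuterMeasure_bind_apply]
    set p := iid (inducedDist S Q) n
    set B := {z | ¬ ∑ T : 𝒯, (Q T).toReal * empErr S (A n z ∘ T.1) ≤ a} with hB
    calc _ ≤ ∑' z, (B.indicator p z + p z * ENNReal.ofReal (R * δ)) := by
          refine ENNReal.tsum_le_tsum fun z => ?_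
          rw [PMF.toOuterMeasure_map_apply]
          by_cases hz : z ∈ B
          · rw [Set.indicator_of_mem hz]
            refine le_add_right (mul_le_of_le_one_right' ?_)
            calc _ ≤ (rounds A n η S R _).toOuterMeasure Set.univ := measure_mono (Set.subset_univ _)
              _ = 1 := (PMF.toOuterMeasure_apply_eq_one_iff _ _).mpr (Set.subset_univ _)
          · refine le_add_left (mul_le_mul_right ((measure_mono ?_).trans (ih _)) _)
            intro hs hhs hgood
            exact hhs (goodRun_cons hη (hAH z) (by simpa [hB] using hz) hgood)
      _ = p.toOuterMeasure B + ENNReal.ofReal (R * δ) := by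
          rw [ENNReal.tsum_add, ENNReal.tsum_mul_right, p.tsum_coe, one_mul,
            PMF.toOuterMeasure_apply]
      _ ≤ ENNReal.ofReal δ + ENNReal.ofReal (R * δ) := add_le_add_left (hround Q) _
      _ = _ := by
          rw [← ENNReal.ofReal_add hδ (by positivity)]
          congr 1
          push_cast
          ring

/-- For `|𝒯| = 1` the prescribed step size is `0`, while the regret bound divides by `η`; here any
positive step gives the same run. -/
theorem rounds_eq_of_subsingleton {X : Type u} {m : ℕ} [NeZero m] {𝒯 : Finset (X → X)}
    [Subsingleton 𝒯] (A : Learner X) (n : ℕ) (η η' : ℝ) (S : Fin m → X × Bool) (R : ℕ) :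
    ∀ Q : PMF 𝒯, rounds A n η S R Q = rounds A n η' S R Q := by
  have hPMF : ∀ Q Q' : PMF 𝒯, Q = Q' := by
    have h1 : ∀ (Q : PMF 𝒯) T, Q T = 1 := fun Q T => by
      rw [← Q.tsum_coe, tsum_eq_single T fun T' h => absurd (Subsingleton.elim _ _) h]
    intro Q Q'
    ext T
    rw [h1, h1]
  induction R with
  | zero => intro Q; rfl
  | succ R ih =>
    intro Q
    rw [rounds, rounds]
    congr 1
    funext z
    rw [ih, hPMF (mwUpdate η Q _)]

/-- The regret bound of Multiplicative Weights on a good run started from uniform weights. -/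
theorem sum_empErr_le_of_goodRun {X : Type u} {m : ℕ} {𝒯 : Finset (X → X)} [Nonempty 𝒯]
    {H : Set (X → Bool)} {η a : ℝ} (hη : 0 < η) {S : Fin m → X × Bool} {R : ℕ}
    {hs : Fin R → X → Bool} (hgood : GoodRun H η a S (PMF.uniformOfFintype 𝒯) hs)
    (hR : Real.log 𝒯.card ≤ R * η ^ 2 / 8) {T : X → X} (hT : T ∈ 𝒯) :
    ∑ r, empErr S (hs r ∘ T) ≤ R * (a + η / 4) := by
  have hN : (0 : ℝ) < 𝒯.card := by
    exact_mod_cast Finset.card_pos.mpr ⟨T, hT⟩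
  have h1 : (PMF.uniformOfFintype 𝒯 ⟨T, hT⟩).toReal *
      Real.exp (∑ r, -η * (1 - empErr S (hs r ∘ T))) ≤
      Real.exp (R * (-η * (1 - a) + η ^ 2 / 8)) :=
    (Finset.single_le_sum (f := fun T : 𝒯 => (PMF.uniformOfFintype 𝒯 T).toReal *
      Real.exp (∑ r, -η * (1 - empErr S (hs r ∘ T.1)))) (fun _ _ => by positivity)
      (Finset.mem_univ ⟨T, hT⟩)).trans hgood.2
  rw [PMF.uniformOfFintype_apply, ENNReal.toReal_inv, ENNReal.toReal_natCast, Fintype.card_coe,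
    inv_mul_le_iff₀ hN, ← Real.exp_log hN, ← Real.exp_add, Real.exp_le_exp] at h1
  rw [← Finset.mul_sum] at h1
  simp only [Finset.sum_sub_distrib, Finset.sum_const, Finset.card_univ, Fintype.card_fin,
    nsmul_eq_mul, mul_one] at h1
  -- `log |𝒯|` and the Hoeffding term contribute at most `R η² / 8` each.
  have h2 : η * ∑ r, empErr S (hs r ∘ T) ≤ η * (R * (a + η / 4)) := by nlinarith
  exact le_of_mul_le_mul_left h2 hη

/-! ### Transfer to the population and conclusion. -/

/-- Uniform convergence of empirical to population errors over `H ∘ 𝒯`. -/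
theorem measure_exists_empErr_deviation_le {X : Type u} [MeasurableSpace X]
    {F : Set (X → Bool)} [Nonempty F] (D : Measure (X × Bool)) [IsProbabilityMeasure D]
    (hF : ∀ f ∈ F, Measurable f) (hFD : MeasurableClass D F) {d : ℕ} (hd : vcDim F = d)
    {m : ℕ} (hm : 0 < m) {ε δ : ℝ} (hε : 0 < ε) (hδ0 : 0 < δ) (hδ : δ ≤ 1 / 2)
    (hmε : 9216 * (d + Real.log (1 / δ)) ≤ m * ε ^ 2) :
    (Measure.pi fun _ : Fin m => D) {S | ∃ f ∈ F, ε < |empErr S f - err D f|} ≤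
      ENNReal.ofReal δ := by
  have hmR : (0 : ℝ) < m := by exact_mod_cast hm
  let g : F → X × Bool → Bool := fun f z => decide (f.1 z.1 ≠ z.2)
  have hvc : ∀ s : Finset (X × Bool), Shatters (Set.range g) s → s.card ≤ d := by
    intro s hs
    rw [← Nat.cast_le (α := ℕ∞), ← hd]
    exact card_le_vcDim_of_realizes (realizes_of_shatters_loss (π := Prod.fst) (y := Prod.snd) hs)
  have hg : ∀ f, Measurable (g f) := by
    intro f
    have h2 : Measurable fun q : Bool × Bool => decide (q.1 ≠ q.2) := measurable_of_countable _
    exact h2.comp (((hF f.1 f.2).comp measurable_fst).prodMk measurable_snd)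
  have hval : ∀ (f : F) z, boolVal (g f z) = loss f.1 z := fun f z => boolVal_decide_ne f.1 z
  have h := uniform_convergence D hvc hg hm (fun e => by simpa only [hval] using hFD (m + m) e)
    hε hδ0 hδ hmε
  refine (measure_mono ?_).trans h
  rintro S ⟨f, hf, hdev⟩
  refine ⟨⟨f, hf⟩, ?_⟩
  have h1 : ∑ j, boolVal (g ⟨f, hf⟩ (S j)) = m * empErr S f := by
    rw [empErr, mul_div_cancel₀ _ hmR.ne']
    exact Finset.sum_congr rfl fun j _ => hval ⟨f, hf⟩ (S j)
  have h2 : D.real {x | g ⟨f, hf⟩ x = true} = err D f := by simp [g, err]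
  rw [h1, h2, ← mul_sub, abs_mul, abs_of_pos hmR]
  exact mul_lt_mul_of_pos_left hdev hmR

/-- Subadditivity over the slices of constant `r`, which needs no measurability of the predictors.
-/
theorem mixErr_le {X : Type u} [MeasurableSpace X] {R : ℕ} [NeZero R] (D : Measure (X × Bool))
    [IsProbabilityMeasure D] (hs : Fin R → X → Bool) (T : X → X) :
    mixErr D hs T ≤ (∑ r, err D (hs r ∘ T)) / R := by
  have hset : {p : (X × Bool) × Fin R | hs p.2 (T p.1.1) ≠ p.1.2} =
      ⋃ r, {z : X × Bool | (hs r ∘ T) z.1 ≠ z.2} ×ˢ {r} := by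
    ext p
    simp
  rw [mixErr, hset]
  refine (measureReal_iUnion_fintype_le _).trans_eq ?_
  rw [Finset.sum_div]
  refine Finset.sum_congr rfl fun r _ => ?_
  rw [measureReal_prod_prod, err, measureReal_def (s := {r}),
    PMF.toMeasure_apply_singleton _ _ (measurableSet_singleton r), PMF.uniformOfFintype_apply]
  simp [div_eq_mul_inv]

theorem err_le_iSup {X : Type u} [MeasurableSpace X] (D : Measure (X × Bool))
    [IsProbabilityMeasure D] {𝒯 : Finset (X → X)} (h : X → Bool) (T : 𝒯) :
    err D (h ∘ T.1) ≤ ⨆ T : 𝒯, err D (h ∘ T.1) :=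
  le_ciSup (f := fun T : 𝒯 => err D (h ∘ T.1)) (Set.finite_range _).bddAbove T

/-- On a sample with uniformly accurate empirical errors, the algorithm succeeds with high
probability over its internal sampling. -/
theorem algorithm_success {X : Type u} [MeasurableSpace X] {H : Set (X → Bool)}
    {𝒯 : Finset (X → X)} [Nonempty 𝒯] {D : Measure (X × Bool)} [IsProbabilityMeasure D]
    {A : Learner X} (hA : IsERM H A) {k : ℕ}
    (hk : min (vcDim H) (𝒯.card * vcDim (compClass H 𝒯)) = k) {ε δ : ℝ} (hε : 0 < ε)
    (hδ0 : 0 < δ) (hδ : δ ≤ 1 / 2) {m R n : ℕ} [NeZero m] [NeZero R] (hn : 0 < n)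
    (hR : 8 * Real.log 𝒯.card / ε ^ 2 ≤ R)
    (hnε : 9216 * (k + Real.log (R / δ)) ≤ n * (ε / 16) ^ 2) {S : Fin m → X × Bool}
    (hS : ∀ f ∈ compClass H 𝒯, |empErr S f - err D f| ≤ ε / 8) :
    ENNReal.ofReal (1 - δ) ≤ (algorithm 𝒯 A n R S).toOuterMeasure
      {hs | ∀ T ∈ 𝒯, mixErr D hs T ≤ optInf D H 𝒯 + ε} := by
  have hR1 : (1 : ℝ) ≤ R := by exact_mod_cast NeZero.one_le
  have hR0 : (0 : ℝ) < R := by linarith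
  have : Nonempty H := ⟨⟨A 0 Fin.elim0, (hA 0 _).1⟩⟩
  have hAH : ∀ z : Fin n → X × Bool, A n z ∈ H := fun z => (hA n z).1
  -- Budget: `2 · ε / 16` for ERM and `ε / 8` for the comparator on `S` make `ε / 4`. Regret adds at
  -- most `ε / 4` and the return to `D` adds `ε / 8`, for a total below `ε`.
  have hround : ∀ Q : PMF 𝒯, (iid (inducedDist S Q) n).toOuterMeasure
      {z | ¬ ∑ T : 𝒯, (Q T).toReal * empErr S (A n z ∘ T.1) ≤ optInf D H 𝒯 + ε / 4} ≤
      ENNReal.ofReal (δ / R) := by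
    intro Q
    have h1 := round_excess_error hA hk S Q hn (ε := ε / 16) (δ := δ / R) (by positivity)
      (by positivity) ((div_le_self hδ0.le hR1).trans hδ) (by rwa [one_div_div])
    refine (measure_mono ?_).trans h1
    intro z hz hcon
    refine hz ?_
    rw [← sub_le_iff_le_add]
    -- `OPT` need not be attained, so every comparator `h` is treated before taking the infimum.
    refine le_ciInf fun h => ?_
    have h2 : ∑ T : 𝒯, (Q T).toReal * empErr S (h.1 ∘ T.1) ≤
        ∑ T : 𝒯, (Q T).toReal * ((⨆ T : 𝒯, err D (h.1 ∘ T.1)) + ε / 8) := by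
      refine Finset.sum_le_sum fun T _ => mul_le_mul_of_nonneg_left ?_ ENNReal.toReal_nonneg
      have h3 := (abs_le.mp (hS (h.1 ∘ T.1) ⟨h.1, h.2, T.1, T.2, rfl⟩)).2
      linarith [err_le_iSup D h.1 T]
    rw [← Finset.sum_mul, sum_toReal_eq_one, one_mul] at h2
    linarith [hcon h.1 h.2]
  obtain ⟨η, hη0, hηε, hηR, halg⟩ : ∃ η : ℝ, 0 < η ∧ η ≤ ε ∧ Real.log 𝒯.card ≤ R * η ^ 2 / 8 ∧
      algorithm 𝒯 A n R S = rounds A n η S R (PMF.uniformOfFintype 𝒯) := by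
    have hcard : 0 < 𝒯.card := by
      rw [← Fintype.card_coe]; exact Fintype.card_pos
    rcases Nat.lt_or_ge 1 𝒯.card with h1 | h1
    · have hlog : 0 < Real.log 𝒯.card := Real.log_pos (by exact_mod_cast h1)
      refine ⟨Real.sqrt (8 * Real.log 𝒯.card / R), by positivity, ?_, ?_, rfl⟩
      · rw [Real.sqrt_le_left hε.le, div_le_iff₀ hR0]
        rw [div_le_iff₀ (by positivity)] at hR
        linarith
      · rw [Real.sq_sqrt (by positivity)]
        apply le_of_eq
        field_simp
    · have hc : 𝒯.card = 1 := by omega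
      have : Subsingleton 𝒯 := by
        rw [← Fintype.card_le_one_iff_subsingleton, Fintype.card_coe]; exact h1
      refine ⟨ε, hε, le_rfl, ?_, rounds_eq_of_subsingleton A n _ _ S R _⟩
      rw [hc, Nat.cast_one, Real.log_one]
      positivity
  rw [halg]
  have hbad := rounds_goodRun (η := η) hη0.le (by positivity : 0 ≤ δ / R) hAH hround R
    (PMF.uniformOfFintype 𝒯)
  rw [mul_div_cancel₀ _ hR0.ne'] at hbad
  refine one_sub_le_of_compl_le _ _ hδ0.le ((measure_mono ?_).trans hbad)
  intro hs hhs hgood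
  refine hhs fun T hT => ?_
  have h1 := sum_empErr_le_of_goodRun hη0 hgood hηR hT
  refine (mixErr_le D hs T).trans ?_
  rw [div_le_iff₀ hR0]
  have h2 : ∑ r, err D (hs r ∘ T) ≤ ∑ r, (empErr S (hs r ∘ T) + ε / 8) := by
    refine Finset.sum_le_sum fun r _ => ?_
    have := (abs_le.mp (hS (hs r ∘ T) ⟨hs r, hgood.1 r, T, hT, rfl⟩)).1
    linarith
  rw [Finset.sum_add_distrib, Finset.sum_const, Finset.card_univ, Fintype.card_fin,
    nsmul_eq_mul] at h2
  nlinarith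

end TransformLearning

open TransformLearning in
theorem theorem3 :
    ∃ C : ℝ, 0 < C ∧
      ∀ (X : Type*) [MeasurableSpace X]
        (H : Set (X → Bool)) (𝒯 : Finset (X → X)) [Nonempty 𝒯]
        (D : Measure (X × Bool)) [IsProbabilityMeasure D]
        (_ : ∀ f ∈ compClass H 𝒯, Measurable f)
        (_ : MeasurableClass D (compClass H 𝒯))
        (ERM : Learner X) (_ : IsERM H ERM)
        (d : ℕ) (_ : vcDim (compClass H 𝒯) = d)
        (k : ℕ) (_ : min (vcDim H) (𝒯.card * vcDim (compClass H 𝒯)) = k)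
        (ε δ δ' : ℝ) (_ : 0 < ε) (_ : ε < 1 / 2) (_ : 0 < δ) (_ : δ < 1 / 2)
        (_ : 0 < δ') (_ : δ' < 1 / 2)
        (m R n : ℕ) [NeZero m] [NeZero R]
        (_ : C * (d + Real.log (1 / δ)) / ε ^ 2 ≤ m)
        (_ : 8 * Real.log 𝒯.card / ε ^ 2 ≤ R)
        (_ : C * (k + Real.log (R / δ')) / ε ^ 2 ≤ n),
        (Measure.pi fun _ : Fin m => D)
          {S | ¬ ENNReal.ofReal (1 - δ') ≤
            (algorithm 𝒯 ERM n R S).toOuterMeasure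
              {hs | ∀ T ∈ 𝒯, mixErr D hs T ≤ optInf D H 𝒯 + ε}} ≤ ENNReal.ofReal δ := by
  -- `256 = 16²` comes from the accuracy `ε / 16` within a round; the sample `S` only needs `ε / 8`.
  refine ⟨9216 * 256, by norm_num, ?_⟩
  intro X _ H 𝒯 _ D _ hmeas hclass ERM hERM d hd k hk ε δ δ' hε _ hδ0 hδ hδ'0 hδ' m R n _ _ hm hR hn
  have hR1 : (1 : ℝ) ≤ R := by exact_mod_cast NeZero.one_le
  have hd0 : (0 : ℝ) ≤ d := Nat.cast_nonneg d
  have hk0 : (0 : ℝ) ≤ k := Nat.cast_nonneg k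
  have hlogδ : 0 < Real.log (1 / δ) := Real.log_pos (by rw [lt_div_iff₀ hδ0]; linarith)
  have hlogR : 0 < Real.log (R / δ') := Real.log_pos (by rw [lt_div_iff₀ hδ'0]; linarith)
  have hn0 : (0 : ℝ) < n := lt_of_lt_of_le (by positivity) hn
  rw [div_le_iff₀ (by positivity)] at hm hn
  obtain ⟨T₀⟩ := ‹Nonempty 𝒯›
  have : Nonempty 𝒯 := ⟨T₀⟩
  have : Nonempty (compClass H 𝒯) :=
    ⟨⟨ERM 0 Fin.elim0 ∘ T₀.1, _, (hERM 0 _).1, T₀.1, T₀.2, rfl⟩⟩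
  refine (measure_mono ?_).trans (measure_exists_empErr_deviation_le D hmeas hclass hd
    (NeZero.pos m) (ε := ε / 8) (by positivity) hδ0 hδ.le (by nlinarith))
  intro S hS
  by_contra hcon
  refine hS (algorithm_success hERM hk hε hδ'0 hδ'.le (by exact_mod_cast hn0) hR (by linarith)
    fun f hf => ?_)
  by_contra hlt
  exact hcon ⟨f, hf, not_le.mp hlt⟩
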